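/- Fix $\alpha\in\mathbb R$. There are a constant $C>0$ and an integer $m\ge 0$, depending only on $\alpha$, such that the following holds for every dimension $d$, every Borel probability measure $p_X$ on $\mathbb R^d$ whose support $\mathcal X$ is contained in the closed ball of centre $0$ and radius $R$ for some $R>0$ (A1), all $0<\sigma_T<\sigma_0$, and every noise level $\sigma_t\in[\sigma_T,\sigma_0]$. Let $\mathsf k = 1+\log N_{\mathcal X}(r_0)$ be the intrinsic dimension of $p_X$ at scale $r_0=\sigma_T^2/(\sigma_0\sqrt d)$, where $N_{\mathcal X}(r)$ is the minimal number of Euclidean balls of radius $r$ needed to cover $\mathcal X$. For $y\in\mathbb R^d$ let $\mu(\cdot\,|\,y)$ be the posterior on the noise level under the prior $\Theta(\sigma)\propto\sigma^{\alpha-3}$ on $[\sigma_T,\sigma_0]$, that is, the probability measure on $[\sigma_T,\sigma_0]$ with density $$\mu(\sigma\,|\,y)\;\propto\;\frac{\Theta(\sigma)}{\sigma^{d}}\;\mathbb E_{X\sim p_X}\Bigl[\exp\Bigl(-\frac{\|X-y\|^2}{2\sigma^2}\Bigr)\Bigr],$$ and let $\nu(\cdot\,|\,y)$ be the law of $\lambda=\sigma^{-2}$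 for $\sigma\sim\mu(\cdot\,|\,y)$. Put $\lambda_t=\sigma_t^{-2}$. If $C\,(1+\log d)^m\,\mathsf k^2\le d$ (A2), then for $X_t\sim p_{\sigma_t}=p_X*\mathcal N(0,\sigma_t^2 I)$ and $\lambda\sim\nu(\cdot\,|\,X_t)$, $$\mathbb E|\lambda-\lambda_t|^2\;\le\; C\,(1+\log d)^m\,\lambda_t^2\Bigl(\frac1d+\frac{\mathsf k^2}{d^2}\Bigr).$$ -/

import Mathlib

open MeasureTheory ProbabilityTheory

noncomputable section

namespace BlindDenoise

variable {d : ℕ}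

/-- The noisy data distribution `p_σ = p_X * N(0, σ² I)`. -/
def noisyLaw (pX : Measure (EuclideanSpace ℝ (Fin d))) (σ : ℝ) :
    Measure (EuclideanSpace ℝ (Fin d)) :=
  pX.conv ((stdGaussian (EuclideanSpace ℝ (Fin d))).map (fun z => σ • z))

/-- The intrinsic dimension `1 + log N_𝒳(r)` at scale `r`, where `𝒳 = supp p_X` and `N_𝒳(r)` is the
minimal number of (closed) balls of radius `r`, with arbitrary centres, that cover `𝒳`. It is used
for bounded `𝒳` and `r > 0` only, where this number is finite. -/
def intrinsicDim (pX : Measure (EuclideanSpace ℝ (Fin d))) (r : ℝ) : ℝ :=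
  1 + Real.log ((Metric.externalCoveringNumber r.toNNReal pX.support).toNat : ℝ)

/-- The covering scale `σ_T² / (σ_0 √d)`. -/
def coverScale (d : ℕ) (σT σ0 : ℝ) : ℝ := σT ^ 2 / (σ0 * Real.sqrt d)

/-- The unnormalised power-law prior density `Θ(σ) ∝ σ^(α - 3)` on the noise level `σ`. -/
def powerPrior (α σ : ℝ) : ℝ := σ ^ (α - 3)

/-- The unnormalised posterior density of the noise level `σ` given the noisy sample `y`:
`Θ(σ) / σ^d * E_{X ∼ p_X}[exp(-σ⁻² ‖X - y‖² / 2)]`. -/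
def noiseWeight (pX : Measure (EuclideanSpace ℝ (Fin d))) (α : ℝ)
    (y : EuclideanSpace ℝ (Fin d)) (σ : ℝ) : ℝ :=
  powerPrior α σ / σ ^ d * ∫ x, Real.exp (-((σ ^ 2)⁻¹ / 2) * ‖x - y‖ ^ 2) ∂pX

/-- The unnormalised posterior of the noise level, carried by `[σ_T, σ_0]`. -/
def noiseWeightMeasure (pX : Measure (EuclideanSpace ℝ (Fin d))) (α σT σ0 : ℝ)
    (y : EuclideanSpace ℝ (Fin d)) : Measure ℝ :=
  (volume.restrict (Set.Icc σT σ0)).withDensity (fun σ => ENNReal.ofReal (noiseWeight pX α y σ))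

/-- The posterior `μ(· | y)` of the noise level `σ ∈ [σ_T, σ_0]` given the noisy sample `y`. -/
def noisePosterior (pX : Measure (EuclideanSpace ℝ (Fin d))) (α σT σ0 : ℝ)
    (y : EuclideanSpace ℝ (Fin d)) : Measure ℝ :=
  (noiseWeightMeasure pX α σT σ0 y Set.univ)⁻¹ • noiseWeightMeasure pX α σT σ0 y

/-- The posterior `ν(· | y)` of `λ = σ⁻²`: the law of `σ⁻²` for `σ ∼ μ(· | y)`. -/
def precisionPosterior (pX : Measure (EuclideanSpace ℝ (Fin d))) (α σT σ0 : ℝ)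
    (y : EuclideanSpace ℝ (Fin d)) : Measure ℝ :=
  (noisePosterior pX α σT σ0 y).map (fun σ => (σ ^ 2)⁻¹)

theorem measurable_noiseWeight (pX : Measure (EuclideanSpace ℝ (Fin d))) [IsProbabilityMeasure pX]
    (α : ℝ) (y : EuclideanSpace ℝ (Fin d)) : Measurable (noiseWeight pX α y) := by
  have h : Measurable (fun σ : ℝ => ∫ x, Real.exp (-((σ ^ 2)⁻¹ / 2) * ‖x - y‖ ^ 2) ∂pX) := by
    apply StronglyMeasurable.measurable
    apply StronglyMeasurable.integral_prod_right
      (f := fun (σ : ℝ) x => Real.exp (-((σ ^ 2)⁻¹ / 2) * ‖x - y‖ ^ 2))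
    apply Measurable.stronglyMeasurable
    simp only [Function.uncurry_def]
    fun_prop
  unfold noiseWeight powerPrior
  fun_prop

/-- The normalisation in `noisePosterior` is by a positive finite number. -/
theorem isProbabilityMeasure_noisePosterior (pX : Measure (EuclideanSpace ℝ (Fin d)))
    [IsProbabilityMeasure pX] (α : ℝ) {σT σ0 : ℝ} (hT : 0 < σT) (h : σT < σ0)
    (y : EuclideanSpace ℝ (Fin d)) :
    IsProbabilityMeasure (noisePosterior pX α σT σ0 y) := by
  have hint : ∀ σ : ℝ,
      Integrable (fun x => Real.exp (-((σ ^ 2)⁻¹ / 2) * ‖x - y‖ ^ 2)) pX := by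
    intro σ
    refine Integrable.mono' (integrable_const (1 : ℝ)) ?_ ?_
    · exact Measurable.aestronglyMeasurable (by fun_prop)
    · refine Filter.Eventually.of_forall fun x => ?_
      rw [Real.norm_eq_abs, abs_of_pos (Real.exp_pos _)]
      apply Real.exp_le_one_iff.2
      have h1 : 0 ≤ (σ ^ 2)⁻¹ / 2 := by positivity
      nlinarith [mul_nonneg h1 (sq_nonneg ‖x - y‖)]
  have hpos : ∀ σ ∈ Set.Icc σT σ0, 0 < noiseWeight pX α y σ := by
    intro σ hσ
    have hσ0 : 0 < σ := hT.trans_le hσ.1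
    exact mul_pos (div_pos (Real.rpow_pos_of_pos hσ0 _) (pow_pos hσ0 _))
      (integral_exp_pos (hint σ))
  have hle : ∀ σ ∈ Set.Icc σT σ0, noiseWeight pX α y σ ≤ powerPrior α σ / σ ^ d := by
    intro σ hσ
    have hσ0 : 0 < σ := hT.trans_le hσ.1
    have h2 : ∫ x, Real.exp (-((σ ^ 2)⁻¹ / 2) * ‖x - y‖ ^ 2) ∂pX ≤ ∫ _x, (1 : ℝ) ∂pX := by
      refine integral_mono (hint σ) (integrable_const _) fun x => ?_
      apply Real.exp_le_one_iff.2
      have h1 : 0 ≤ (σ ^ 2)⁻¹ / 2 := by positivity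
      nlinarith [mul_nonneg h1 (sq_nonneg ‖x - y‖)]
    have h3 : 0 ≤ powerPrior α σ / σ ^ d :=
      (div_pos (Real.rpow_pos_of_pos hσ0 _) (pow_pos hσ0 _)).le
    calc noiseWeight pX α y σ ≤ powerPrior α σ / σ ^ d * 1 := by
          refine mul_le_mul_of_nonneg_left (by simpa using h2) h3
      _ = _ := mul_one _
  have hcont : ContinuousOn (fun σ : ℝ => powerPrior α σ / σ ^ d) (Set.Icc σT σ0) := by
    intro σ hσ
    have hσ0 : 0 < σ := hT.trans_le hσ.1
    apply ContinuousAt.continuousWithinAt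
    exact (Real.continuousAt_rpow_const _ _ (Or.inl hσ0.ne')).div (by fun_prop)
      (pow_pos hσ0 _).ne'
  have hfin : noiseWeightMeasure pX α σT σ0 y Set.univ ≠ ⊤ := by
    unfold noiseWeightMeasure
    rw [withDensity_apply _ MeasurableSet.univ, Measure.restrict_univ]
    have hI : IntegrableOn (fun σ : ℝ => powerPrior α σ / σ ^ d) (Set.Icc σT σ0) :=
      hcont.integrableOn_Icc
    refine ne_top_of_le_ne_top hI.lintegral_lt_top.ne ?_
    exact setLIntegral_mono' measurableSet_Icc fun σ hσ => ENNReal.ofReal_le_ofReal (hle σ hσ)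
  have hne : noiseWeightMeasure pX α σT σ0 y Set.univ ≠ 0 := by
    unfold noiseWeightMeasure
    rw [withDensity_apply _ MeasurableSet.univ, Measure.restrict_univ]
    refine ne_of_gt (setLIntegral_pos_iff ?_ |>.2 ?_)
    · exact (measurable_noiseWeight pX α y).ennreal_ofReal
    · refine lt_of_lt_of_le (b := volume (Set.Icc σT σ0)) (by simpa using h) ?_
      refine measure_mono fun σ hσ => ⟨?_, hσ⟩
      simpa using hpos σ hσ
  refine ⟨?_⟩
  simp only [noisePosterior, Measure.smul_apply, smul_eq_mul]
  exact ENNReal.inv_mul_cancel hne hfin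

theorem isProbabilityMeasure_precisionPosterior (pX : Measure (EuclideanSpace ℝ (Fin d)))
    [IsProbabilityMeasure pX] (α : ℝ) {σT σ0 : ℝ} (hT : 0 < σT) (h : σT < σ0)
    (y : EuclideanSpace ℝ (Fin d)) :
    IsProbabilityMeasure (precisionPosterior pX α σT σ0 y) := by
  have := isProbabilityMeasure_noisePosterior pX α hT h y
  exact Measure.isProbabilityMeasure_map (by fun_prop)

end BlindDenoise

end

/-!
Write `y = x₀ + σ_t g` with `x₀ ∼ p_X` and `g` standard Gaussian, and measure the precision in units
of its true value, `u = λ / λ_t = σ_t² / σ²`. Given `y`, the posterior of `u` has density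
proportional to `u ^ p * E_X[exp(-u ‖ξ + g‖² / 2)]` on an interval containing `1`, where
`p = (d - α) / 2` and `ξ = (x₀ - X) / σ_t` (`lintegral_precisionPosterior_le`). The second factor is
`exp(-u ‖g‖² / 2 + h u)`, where `h u = log E_X[exp(-u S / 2)]` and `S = ‖ξ‖² + 2 ⟪ξ, g⟫`. Hence the
density is that of a Gamma law whose mode is `1` and whose width is of order `1 / √d`, up to the
perturbations `(p - ‖g‖² / 2) (u - 1)` and `h` of its logarithm.

The function `h` is convex and vanishes at `0`. Cover the support by `N` balls of radius
`σ_T² / (σ_0 √d)`, and let `b = σ_t² / σ_T²` be the largest value of `u`. The radius is such that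
`2 ⟪ξ, g⟫` varies by `O(1 / b)` inside a ball. Outside an event of probability `O(1 / d)` the
signal `x₀` lies in a ball of mass at least `1 / (N d)`, on which `S ≤ O(1 / b)`, and a union bound
over the centres gives `S ≥ -O(log (N d) + 1 / b)` on the whole support. So
`-A ≤ h u ≤ A (1 + u)` on `[0, 2 b]` with `A` of order `1 + log (N d)`, and convexity makes `h`
Lipschitz at `1` with constant `4 A` on `[0, b]` (`abs_sub_apply_one_le_of_convexOn`). With
`Λ = 1 + √p + |p - ‖g‖² / 2| + O(A)` the posterior mean of `(u - 1)²` is then `O(Λ² / p²)` on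
`u ≤ 64` (`setLIntegral_sq_sub_one_mul_le`), and the mean of `Λ²` is `O(d + A²)`.

On the exceptional event `(u - 1)²` is bounded by `64²` as long as `u ≤ 64`. Larger values of `u`
are exponentially unlikely in `d` for every signal: comparing `u` with `[u / 4, u / 2]`
(`ofReal_precisionDensity_le_of_exp_le`) bounds the normalised density at `u`, up to a constant, by
`4 ^ p / u` times a sum over the centres of `exp(-u ‖ξ + g‖² / 8)`, whose mean over `g` is at most
`N (1 + u / 4) ^ (-d / 2)` (`lintegral_precisionTail_le`).
-/

namespace BlindDenoise

/-! ### Gaussian integrals -/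

theorem lintegral_exp_quadratic_gaussianReal {τ : ℝ} (hτ : 0 < 1 + 2 * τ) (w : ℝ) :
    ∫⁻ z, ENNReal.ofReal (Real.exp (-τ * z ^ 2 + w * z)) ∂(gaussianReal 0 1)
      = ENNReal.ofReal ((Real.sqrt (1 + 2 * τ))⁻¹ * Real.exp (w ^ 2 / (2 * (1 + 2 * τ)))) := by
  set s : ℝ := 1 + 2 * τ with hs
  -- Completing the square turns the integrand into a multiple of a Gaussian density of
  -- variance `1 / s`.
  obtain ⟨v, hvs⟩ : ∃ v : NNReal, (v : ℝ) = s⁻¹ :=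
    ⟨Real.toNNReal s⁻¹, Real.coe_toNNReal _ (by positivity)⟩
  have hv : v ≠ 0 := by
    rintro rfl
    exact (inv_pos.2 hτ).ne hvs
  rw [gaussianReal_of_var_ne_zero _ one_ne_zero,
    lintegral_withDensity_eq_lintegral_mul _ (measurable_gaussianPDF _ _) (by fun_prop)]
  have key : ∀ z : ℝ, (gaussianPDF 0 1 * fun z => ENNReal.ofReal (Real.exp (-τ * z ^ 2 + w * z))) z
      = ENNReal.ofReal ((Real.sqrt s)⁻¹ * Real.exp (w ^ 2 / (2 * s)))
        * gaussianPDF (w / s) v z := by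
    intro z
    simp only [Pi.mul_apply, gaussianPDF]
    rw [← ENNReal.ofReal_mul (gaussianPDFReal_nonneg _ _ _), ← ENNReal.ofReal_mul (by positivity)]
    congr 1
    simp only [gaussianPDFReal, NNReal.coe_one, hvs]
    have h1 : Real.sqrt (2 * Real.pi * s⁻¹) = Real.sqrt (2 * Real.pi) * (Real.sqrt s)⁻¹ := by
      rw [Real.sqrt_mul (by positivity), Real.sqrt_inv]
    have h2 : Real.sqrt s ≠ 0 := (Real.sqrt_pos.2 hτ).ne'
    rw [h1, mul_one, mul_assoc, ← Real.exp_add]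
    have h3 : -(z - 0) ^ 2 / (2 * 1) + (-τ * z ^ 2 + w * z)
        = w ^ 2 / (2 * s) + -(z - w / s) ^ 2 / (2 * s⁻¹) := by
      have : s ≠ 0 := hτ.ne'
      have hτ' : τ = (s - 1) / 2 := by rw [hs]; ring
      rw [hτ']
      field_simp
      ring
    rw [h3, Real.exp_add]
    have h4 : Real.sqrt (2 * Real.pi) ≠ 0 := by positivity
    field_simp
  simp_rw [key]
  rw [lintegral_const_mul _ (measurable_gaussianPDF _ _), lintegral_gaussianPDF_eq_one _ hv,
    mul_one]

theorem lintegral_exp_quadratic_stdGaussian {d : ℕ} {τ : ℝ} (hτ : 0 < 1 + 2 * τ)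
    (w : EuclideanSpace ℝ (Fin d)) :
    ∫⁻ z, ENNReal.ofReal (Real.exp (-τ * ‖z‖ ^ 2 + inner ℝ w z))
        ∂(stdGaussian (EuclideanSpace ℝ (Fin d)))
      = ENNReal.ofReal
          ((Real.sqrt (1 + 2 * τ))⁻¹ ^ d * Real.exp (‖w‖ ^ 2 / (2 * (1 + 2 * τ)))) := by
  rw [← map_pi_eq_stdGaussian, lintegral_map (by fun_prop) (by fun_prop)]
  have h1 : ∀ z : Fin d → ℝ,
      ENNReal.ofReal (Real.exp (-τ * ‖WithLp.toLp 2 z‖ ^ 2 + inner ℝ w (WithLp.toLp 2 z)))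
        = ∏ i, ENNReal.ofReal (Real.exp (-τ * z i ^ 2 + w i * z i)) := by
    intro z
    rw [← ENNReal.ofReal_prod_of_nonneg (fun _ _ => (Real.exp_pos _).le), ← Real.exp_sum,
      EuclideanSpace.real_norm_sq_eq, Finset.sum_add_distrib, Finset.mul_sum]
    simp [PiLp.inner_apply, mul_comm]
  simp_rw [h1]
  have hind : iIndepFun (fun i (z : Fin d → ℝ) =>
      ENNReal.ofReal (Real.exp (-τ * z i ^ 2 + w i * z i)))
      (Measure.pi fun _ : Fin d => gaussianReal 0 1) :=
    iIndepFun_pi (μ := fun _ : Fin d => gaussianReal 0 1)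
      (X := fun i (x : ℝ) => ENNReal.ofReal (Real.exp (-τ * x ^ 2 + w i * x)))
      (fun i => by fun_prop)
  rw [lintegral_prod_eq_prod_lintegral_of_indepFun Finset.univ _ hind (fun i => by fun_prop)]
  have h2 : ∀ i : Fin d, ∫⁻ z : Fin d → ℝ, ENNReal.ofReal (Real.exp (-τ * z i ^ 2 + w i * z i))
      ∂(Measure.pi fun _ : Fin d => gaussianReal 0 1)
      = ENNReal.ofReal ((Real.sqrt (1 + 2 * τ))⁻¹ * Real.exp (w i ^ 2 / (2 * (1 + 2 * τ)))) := by
    intro i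
    rw [← lintegral_exp_quadratic_gaussianReal hτ,
      ← (measurePreserving_eval (fun _ : Fin d => gaussianReal 0 1) i).lintegral_comp (by fun_prop)]
  simp_rw [h2]
  rw [← ENNReal.ofReal_prod_of_nonneg (fun _ _ => by positivity), Finset.prod_mul_distrib,
    ← Real.exp_sum, EuclideanSpace.real_norm_sq_eq, Finset.sum_div]
  simp

theorem lintegral_exp_neg_norm_add_sq_stdGaussian_le {d : ℕ} {τ : ℝ} (hτ : 0 ≤ τ)
    (v : EuclideanSpace ℝ (Fin d)) :
    ∫⁻ z, ENNReal.ofReal (Real.exp (-τ * ‖v + z‖ ^ 2))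
        ∂(stdGaussian (EuclideanSpace ℝ (Fin d)))
      ≤ ENNReal.ofReal ((Real.sqrt (1 + 2 * τ))⁻¹ ^ d) := by
  have h1 : ∀ z : EuclideanSpace ℝ (Fin d), ENNReal.ofReal (Real.exp (-τ * ‖v + z‖ ^ 2))
      = ENNReal.ofReal (Real.exp (-τ * ‖v‖ ^ 2))
        * ENNReal.ofReal (Real.exp (-τ * ‖z‖ ^ 2 + inner ℝ (-(2 * τ) • v) z)) := by
    intro z
    rw [← ENNReal.ofReal_mul (by positivity), ← Real.exp_add, norm_add_sq_real,
      real_inner_smul_left]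
    ring_nf
  simp_rw [h1]
  rw [lintegral_const_mul _ (by fun_prop), lintegral_exp_quadratic_stdGaussian (by linarith),
    ← ENNReal.ofReal_mul (by positivity)]
  apply ENNReal.ofReal_le_ofReal
  rw [mul_left_comm, ← Real.exp_add]
  refine mul_le_of_le_one_right (by positivity) (Real.exp_le_one_iff.2 ?_)
  rw [norm_smul, Real.norm_eq_abs, mul_pow, sq_abs]
  have h2 : (-(2 * τ)) ^ 2 * ‖v‖ ^ 2 / (2 * (1 + 2 * τ)) ≤ τ * ‖v‖ ^ 2 := by
    rw [div_le_iff₀ (by linarith)]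
    nlinarith [mul_nonneg hτ (sq_nonneg ‖v‖)]
  linarith

theorem exp_neg_sub_sq_le_one_sub {x : ℝ} (hx : |x| ≤ 1 / 2) : Real.exp (-x - x ^ 2) ≤ 1 - x := by
  have hx' := abs_le.1 hx
  have h : 1 ≤ (1 - x) * Real.exp (x + x ^ 2) := by
    rcases le_total 0 x with h0 | h0
    · have := Real.quadratic_le_exp_of_nonneg (x := x + x ^ 2) (by positivity)
      have h3 : 1 ≤ (1 - x) * (1 + (x + x ^ 2) + (x + x ^ 2) ^ 2 / 2) := by
        have : (1 - x) * (1 + (x + x ^ 2) + (x + x ^ 2) ^ 2 / 2) - 1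
            = x ^ 2 / 2 * (1 - x - x ^ 2 - x ^ 3) := by ring
        have h4 : 0 ≤ 1 - x - x ^ 2 - x ^ 3 := by nlinarith [pow_nonneg h0 3, pow_nonneg h0 2]
        nlinarith [mul_nonneg (by positivity : 0 ≤ x ^ 2 / 2) h4]
      exact h3.trans (mul_le_mul_of_nonneg_left this (by linarith))
    · have := Real.add_one_le_exp (x + x ^ 2)
      have h3 : 1 ≤ (1 - x) * (x + x ^ 2 + 1) := by
        nlinarith [mul_nonneg (sq_nonneg x) (neg_nonneg.2 h0)]
      exact h3.trans (mul_le_mul_of_nonneg_left this (by linarith))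
  have h2 : -x - x ^ 2 = -(x + x ^ 2) := by ring
  rw [h2, Real.exp_neg, inv_le_iff_one_le_mul₀ (Real.exp_pos _)]
  exact h

/-- The second moment of `‖z‖² - d` is of order `d`. It is read off from the exponential moments
of order `±1 / (4 √d)` of `‖z‖² - d`, which are bounded. -/
theorem lintegral_norm_sq_sub_dim_sq_stdGaussian_le {d : ℕ} (hd : 0 < d) :
    ∫⁻ z, ENNReal.ofReal ((‖z‖ ^ 2 - d) ^ 2) ∂(stdGaussian (EuclideanSpace ℝ (Fin d)))
      ≤ ENNReal.ofReal (128 * d) := by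
  have hd' : (1 : ℝ) ≤ d := by exact_mod_cast hd
  set s : ℝ := (Real.sqrt d)⁻¹ with hs
  have hs0 : 0 < s := by positivity
  have hs2 : s ^ 2 * d = 1 := by
    rw [hs, inv_pow, Real.sq_sqrt (by positivity)]
    field_simp
  have hs1 : s ≤ 1 := inv_le_one_of_one_le₀ (Real.one_le_sqrt.2 hd')
  have main : ∀ t : ℝ, |t| = s / 4 →
      ∫⁻ z, ENNReal.ofReal (Real.exp (t * (‖z‖ ^ 2 - d)))
        ∂(stdGaussian (EuclideanSpace ℝ (Fin d))) ≤ ENNReal.ofReal 2 := by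
    intro t ht
    have ht2 : |2 * t| ≤ 1 / 2 := by rw [abs_mul, ht]; norm_num; linarith
    have hlow : Real.exp (-(2 * t) - (2 * t) ^ 2) ≤ 1 - 2 * t := exp_neg_sub_sq_le_one_sub ht2
    have hpos : 0 < 1 + 2 * (-t) := by
      have := (Real.exp_pos _).trans_le hlow
      linarith
    have h1 : ∀ z : EuclideanSpace ℝ (Fin d), ENNReal.ofReal (Real.exp (t * (‖z‖ ^ 2 - d)))
        = ENNReal.ofReal (Real.exp (-t * d)) *
          ENNReal.ofReal (Real.exp (-(-t) * ‖z‖ ^ 2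
            + inner ℝ (0 : EuclideanSpace ℝ (Fin d)) z)) := by
      intro z
      rw [← ENNReal.ofReal_mul (by positivity), ← Real.exp_add, inner_zero_left]
      ring_nf
    simp_rw [h1]
    rw [lintegral_const_mul _ (by fun_prop), lintegral_exp_quadratic_stdGaussian hpos,
      ← ENNReal.ofReal_mul (by positivity)]
    apply ENNReal.ofReal_le_ofReal
    have h5 : (Real.sqrt (1 + 2 * (-t)))⁻¹ ≤ Real.exp (t + 2 * t ^ 2) := by
      have : Real.exp (-(t + 2 * t ^ 2)) ≤ Real.sqrt (1 + 2 * (-t)) := by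
        apply Real.le_sqrt_of_sq_le
        rw [← Real.exp_nat_mul]
        convert hlow using 2 <;> push_cast <;> ring
      rw [Real.exp_neg] at this
      exact inv_le_of_inv_le₀ (Real.exp_pos _) this
    have h6 : (Real.sqrt (1 + 2 * (-t)))⁻¹ ^ d ≤ Real.exp (d * (t + 2 * t ^ 2)) := by
      rw [Real.exp_nat_mul]
      exact pow_le_pow_left₀ (by positivity) h5 d
    have h7 : t ^ 2 = s ^ 2 / 16 := by rw [← sq_abs, ht]; ring
    calc _ ≤ Real.exp (-t * d) * (Real.exp (d * (t + 2 * t ^ 2)) * 1) := by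
          simp only [norm_zero]
          gcongr
          norm_num
      _ = Real.exp (1 / 8) := by
          rw [mul_one, ← Real.exp_add]
          congr 1
          rw [h7]
          linear_combination (1 / 8) * hs2
      _ ≤ 2 := by
          have := Real.exp_bound' (x := 1 / 8) (by norm_num) (by norm_num) (n := 1) (by norm_num)
          norm_num at this
          linarith
  have hpt : ∀ z : EuclideanSpace ℝ (Fin d), ENNReal.ofReal ((‖z‖ ^ 2 - d) ^ 2)
      ≤ ENNReal.ofReal (32 * d) * (ENNReal.ofReal (Real.exp (s / 4 * (‖z‖ ^ 2 - d)))
        + ENNReal.ofReal (Real.exp (-(s / 4) * (‖z‖ ^ 2 - d)))) := by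
    intro z
    rw [← ENNReal.ofReal_add (by positivity) (by positivity), ← ENNReal.ofReal_mul (by positivity)]
    apply ENNReal.ofReal_le_ofReal
    set q := ‖z‖ ^ 2 - (d : ℝ)
    have hx : ∀ x : ℝ, x ^ 2 ≤ 2 * (Real.exp x + Real.exp (-x)) := by
      intro x
      rcases le_total 0 x with h | h
      · nlinarith [Real.quadratic_le_exp_of_nonneg h, Real.exp_pos (-x)]
      · nlinarith [Real.quadratic_le_exp_of_nonneg (neg_nonneg.2 h), Real.exp_pos x]
    have h := hx (s / 4 * q)
    rw [← neg_mul] at h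
    have h9 : q ^ 2 = 16 * d * (s / 4 * q) ^ 2 := by linear_combination -q ^ 2 * hs2
    rw [h9]
    calc 16 * (d : ℝ) * (s / 4 * q) ^ 2 ≤ 16 * d * (2 * _) :=
          mul_le_mul_of_nonneg_left h (by positivity)
      _ = _ := by ring
  calc _ ≤ _ := lintegral_mono hpt
    _ = ENNReal.ofReal (32 * d) * (_ + _) := by
        rw [lintegral_const_mul _ (by fun_prop), lintegral_add_left (by fun_prop)]
    _ ≤ ENNReal.ofReal (32 * d) * (ENNReal.ofReal 2 + ENNReal.ofReal 2) := by
        gcongr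
        · exact main _ (abs_of_pos (by positivity))
        · exact main _ (by rw [abs_neg]; exact abs_of_pos (by positivity))
    _ = ENNReal.ofReal (128 * d) := by
        rw [← ENNReal.ofReal_add (by norm_num) (by norm_num), ← ENNReal.ofReal_mul (by positivity)]
        ring_nf

/-! ### Laplace transforms -/

section Laplace

variable {Ω : Type*} [MeasurableSpace Ω] {P : Measure Ω} [IsProbabilityMeasure P] {S : Ω → ℝ}

theorem integrable_exp_neg_half_mul (hS : Measurable S) {M : ℝ} (hM : ∀ᵐ ω ∂P, -M ≤ S ω) {u : ℝ}
    (hu : 0 ≤ u) : Integrable (fun ω => Real.exp (-(u / 2) * S ω)) P := by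
  refine Integrable.mono' (integrable_const (Real.exp (u / 2 * M)))
    (Measurable.aestronglyMeasurable (by fun_prop)) ?_
  filter_upwards [hM] with ω hω
  rw [Real.norm_eq_abs, abs_of_pos (Real.exp_pos _), Real.exp_le_exp]
  nlinarith [mul_le_mul_of_nonneg_left hω (by positivity : 0 ≤ u / 2)]

/-- Hölder's inequality. -/
theorem convexOn_log_integral_exp_neg_half_mul (hS : Measurable S) {M : ℝ}
    (hM : ∀ᵐ ω ∂P, -M ≤ S ω) :
    ConvexOn ℝ (Set.Ici 0) (fun u => Real.log (∫ ω, Real.exp (-(u / 2) * S ω) ∂P)) := by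
  have hI : ∀ u : ℝ, 0 ≤ u → 0 < ∫ ω, Real.exp (-(u / 2) * S ω) ∂P := fun u hu =>
    integral_exp_pos (integrable_exp_neg_half_mul hS hM hu)
  have hL : ∀ u : ℝ, 0 ≤ u → ∫⁻ ω, ENNReal.ofReal (Real.exp (-(u / 2) * S ω)) ∂P
      = ENNReal.ofReal (∫ ω, Real.exp (-(u / 2) * S ω) ∂P) := fun u hu =>
    (ofReal_integral_eq_lintegral_ofReal (integrable_exp_neg_half_mul hS hM hu)
      (Filter.Eventually.of_forall fun _ => (Real.exp_pos _).le)).symm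
  refine ⟨convex_Ici 0, fun x hx y hy s t hs ht hst => ?_⟩
  have hx' : 0 ≤ x := hx
  have hy' : 0 ≤ y := hy
  have hxy : 0 ≤ s * x + t * y := by positivity
  simp only [smul_eq_mul]
  rw [← Real.log_rpow (hI x hx), ← Real.log_rpow (hI y hy),
    ← Real.log_mul (Real.rpow_pos_of_pos (hI x hx) _).ne' (Real.rpow_pos_of_pos (hI y hy) _).ne']
  apply Real.log_le_log (hI _ hxy)
  have hH := ENNReal.lintegral_mul_norm_pow_le (μ := P) (p := s) (q := t)
    (f := fun ω => ENNReal.ofReal (Real.exp (-(x / 2) * S ω)))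
    (g := fun ω => ENNReal.ofReal (Real.exp (-(y / 2) * S ω)))
    (by fun_prop) (by fun_prop) hs ht hst
  have hpt : ∀ ω, ENNReal.ofReal (Real.exp (-(x / 2) * S ω)) ^ s
      * ENNReal.ofReal (Real.exp (-(y / 2) * S ω)) ^ t
      = ENNReal.ofReal (Real.exp (-((s * x + t * y) / 2) * S ω)) := by
    intro ω
    rw [ENNReal.ofReal_rpow_of_nonneg (Real.exp_pos _).le hs,
      ENNReal.ofReal_rpow_of_nonneg (Real.exp_pos _).le ht,
      ← ENNReal.ofReal_mul (by positivity), ← Real.exp_mul, ← Real.exp_mul, ← Real.exp_add]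
    ring_nf
  simp_rw [hpt] at hH
  rw [hL _ hxy, hL x hx, hL y hy, ENNReal.ofReal_rpow_of_nonneg (hI x hx).le hs,
    ENNReal.ofReal_rpow_of_nonneg (hI y hy).le ht,
    ← ENNReal.ofReal_mul (Real.rpow_nonneg (hI x hx).le _)] at hH
  exact (ENNReal.ofReal_le_ofReal_iff (mul_nonneg (Real.rpow_nonneg (hI x hx).le _)
    (Real.rpow_nonneg (hI y hy).le _))).1 hH

end Laplace

/-- A convex function that vanishes at `0` and obeys two-sided bounds on an interval twice as long
as `[0, b]` is Lipschitz around `1` on `[0, b]`: the slopes of its chords through `1` lie between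
those of the chords to `0` and to a point well beyond. -/
theorem abs_sub_apply_one_le_of_convexOn {h : ℝ → ℝ} {A b : ℝ} (hb : 1 ≤ b)
    (hc : ConvexOn ℝ (Set.Ici 0) h) (h0 : h 0 = 0) (hlow : ∀ u ∈ Set.Icc 0 (2 * b), -A ≤ h u)
    (hup : ∀ u ∈ Set.Icc 0 (2 * b), h u ≤ A * (1 + u)) {u : ℝ} (hu : u ∈ Set.Icc 0 b) :
    |h u - h 1| ≤ 4 * A * |u - 1| := by
  have hA : 0 ≤ A := by
    have := hlow 0 ⟨le_rfl, by linarith⟩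
    linarith
  have hl1 := hlow 1 ⟨zero_le_one, by linarith⟩
  have m1 : (1 : ℝ) ∈ Set.Ici (0 : ℝ) := zero_le_one (α := ℝ)
  have m0 : (0 : ℝ) ∈ Set.Ici (0 : ℝ) := le_refl (0 : ℝ)
  have mu : u ∈ Set.Ici (0 : ℝ) := hu.1
  rcases eq_or_ne u 1 with rfl | hne
  · simp
  have hs0 : -A ≤ (h u - h 1) / (u - 1) := by
    have h1 := hc.secant_mono m1 m0 mu zero_ne_one hne hu.1
    rw [h0] at h1
    have : (0 - h 1) / (0 - 1) = h 1 := by ring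
    linarith
  have hs1 : (h u - h 1) / (u - 1) ≤ 4 * A := by
    rcases lt_or_gt_of_ne hne with hlt | hgt
    · have h1 := hc.secant_mono m1 mu (show (2 : ℝ) ∈ Set.Ici (0 : ℝ) by norm_num) hne (by norm_num)
        (by linarith)
      have h2 := hup 2 ⟨by norm_num, by linarith⟩
      have : (h 2 - h 1) / (2 - 1) = h 2 - h 1 := by norm_num
      linarith
    · have h1 := hc.secant_mono m1 mu (show 2 * u ∈ Set.Ici (0 : ℝ) by simp [hu.1]) hne
        (by linarith) (by linarith)
      have h2 := hup (2 * u) ⟨by linarith, by linarith [hu.2]⟩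
      refine h1.trans ?_
      rw [div_le_iff₀ (by linarith)]
      nlinarith
  have hs : |(h u - h 1) / (u - 1)| ≤ 4 * A := abs_le.2 ⟨by linarith, hs1⟩
  rwa [abs_div, div_le_iff₀ (abs_pos.2 (sub_ne_zero.2 hne))] at hs

/-! ### Concentration of one-dimensional densities -/

/-- Obtained from `log u = 2 log √u ≤ 2 (√u - 1)`. -/
theorem sq_sub_one_div_le_sub_one_sub_log {u : ℝ} (hu : 0 < u) (hu' : u ≤ 64) :
    (u - 1) ^ 2 / 81 ≤ u - 1 - Real.log u := by
  set x := Real.sqrt u with hx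
  have hx0 : 0 < x := Real.sqrt_pos.2 hu
  have hxu : x ^ 2 = u := Real.sq_sqrt hu.le
  have hx8 : x ≤ 8 := Real.sqrt_le_iff.2 ⟨by norm_num, by linarith⟩
  have hlog : Real.log u ≤ 2 * (x - 1) := by
    rw [← hxu, Real.log_pow]
    have := Real.log_le_sub_one_of_pos hx0
    push_cast
    linarith
  have h1 : (u - 1) ^ 2 / 81 ≤ (x - 1) ^ 2 := by
    rw [← hxu, div_le_iff₀ (by norm_num)]
    have : (x ^ 2 - 1) ^ 2 = (x - 1) ^ 2 * (x + 1) ^ 2 := by ring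
    rw [this]
    exact mul_le_mul_of_nonneg_left (by nlinarith) (sq_nonneg _)
  nlinarith

theorem neg_two_mul_sq_le_log_sub {v : ℝ} (hv : |v - 1| ≤ 1 / 2) :
    -(2 * (v - 1) ^ 2) ≤ Real.log v - (v - 1) := by
  have hv2 : 1 / 2 ≤ v := by have := (abs_le.1 hv).1; linarith
  have hv0 : 0 < v := by linarith
  have h1 := Real.one_sub_inv_le_log_of_pos hv0
  have h2 : 1 - v⁻¹ - (v - 1) = -((v - 1) ^ 2 * v⁻¹) := by field_simp; ring
  have h3 : v⁻¹ ≤ 2 := by rw [inv_le_comm₀ hv0 (by norm_num)]; linarith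
  nlinarith [mul_le_mul_of_nonneg_left h3 (sq_nonneg (v - 1))]

theorem lintegral_sq_mul_exp_neg_abs_le {Λ : ℝ} (hΛ : 0 < Λ) :
    ∫⁻ u : ℝ, ENNReal.ofReal ((u - 1) ^ 2 * Real.exp (-Λ * |u - 1|))
      ≤ ENNReal.ofReal (84 / Λ ^ 3) := by
  have hpt : ∀ u : ℝ, (u - 1) ^ 2 * Real.exp (-Λ * |u - 1|)
      ≤ 26 / Λ ^ 2 * (1 + (Λ * (u - 1)) ^ 2)⁻¹ := by
    intro u
    set x := Λ * |u - 1| with hx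
    have hx0 : 0 ≤ x := by positivity
    have hx2 : (Λ * (u - 1)) ^ 2 = x ^ 2 := by rw [hx, mul_pow, mul_pow, sq_abs]
    have e1 : x ^ 2 ≤ 2 * Real.exp x := by nlinarith [Real.quadratic_le_exp_of_nonneg hx0]
    have e2 : x ^ 4 ≤ 24 * Real.exp x := by
      have := Real.pow_div_factorial_le_exp x hx0 4
      have h4 : ((Nat.factorial 4 : ℕ) : ℝ) = 24 := by norm_num [Nat.factorial]
      rw [h4, div_le_iff₀ (by norm_num)] at this
      linarith
    have h3 : (u - 1) ^ 2 = x ^ 2 / Λ ^ 2 := by rw [hx, mul_pow, sq_abs]; field_simp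
    rw [hx2, h3, neg_mul, ← hx, Real.exp_neg, ← div_eq_mul_inv, ← div_eq_mul_inv, div_div, div_div,
      div_le_div_iff₀ (by positivity) (by positivity)]
    nlinarith [mul_le_mul_of_nonneg_left (add_le_add e1 e2) (sq_nonneg Λ)]
  have hint : Integrable (fun u : ℝ => 26 / Λ ^ 2 * (1 + (Λ * (u - 1)) ^ 2)⁻¹) :=
    ((integrable_inv_one_add_sq.comp_mul_left' hΛ.ne').comp_sub_right 1).const_mul _
  calc _ ≤ ∫⁻ u : ℝ, ENNReal.ofReal (26 / Λ ^ 2 * (1 + (Λ * (u - 1)) ^ 2)⁻¹) :=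
        lintegral_mono fun u => ENNReal.ofReal_le_ofReal (hpt u)
    _ = ENNReal.ofReal (∫ u : ℝ, 26 / Λ ^ 2 * (1 + (Λ * (u - 1)) ^ 2)⁻¹) :=
        (ofReal_integral_eq_lintegral_ofReal hint
          (Filter.Eventually.of_forall fun u => by positivity)).symm
    _ ≤ _ := by
        apply ENNReal.ofReal_le_ofReal
        rw [integral_const_mul, integral_sub_right_eq_self (fun u : ℝ => (1 + (Λ * u) ^ 2)⁻¹) 1,
          Measure.integral_comp_mul_left (fun u : ℝ => (1 + u ^ 2)⁻¹) Λ,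
          integral_univ_inv_one_add_sq,
          smul_eq_mul, abs_of_pos (by positivity)]
        have : 26 / Λ ^ 2 * (Λ⁻¹ * Real.pi) = 26 * Real.pi / Λ ^ 3 := by field_simp
        rw [this]
        gcongr
        linarith [Real.pi_lt_d2]

/-- A density on `[a, b] ∋ 1` that is a Gamma density with mode `1` and exponent `p`, up to a
perturbation of its logarithm that is `Λ`-Lipschitz at `1`, lives at distance `O(Λ / p)` of `1`
once `Λ² ≥ p`. -/
theorem setLIntegral_sq_sub_one_mul_le {a b p Λ c : ℝ} (ha : 0 < a) (ha1 : a ≤ 1) (hb : 1 ≤ b)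
    (hp : 0 < p) (hΛ : 1 ≤ Λ) (hpΛ : p ≤ Λ ^ 2) (hc : 0 < c) {W e : ℝ → ℝ}
    (hW : ∀ u ∈ Set.Icc a b, W u = c * Real.exp (p * Real.log u - p * (u - 1) + e u))
    (he : ∀ u ∈ Set.Icc a b, |e u| ≤ Λ * |u - 1|) :
    ∫⁻ u in Set.Icc a b ∩ Set.Iic 64, ENNReal.ofReal ((u - 1) ^ 2) * ENNReal.ofReal (W u)
      ≤ ENNReal.ofReal (27000 * (Λ ^ 2 / p ^ 2)) * ∫⁻ u in Set.Icc a b, ENNReal.ofReal (W u) := by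
  have hΛ0 : 0 < Λ := by linarith
  have hQ : 1 / Λ ^ 2 ≤ Λ ^ 2 / p ^ 2 := by
    rw [div_le_div_iff₀ (by positivity) (by positivity)]
    nlinarith
  set Z := ∫⁻ u in Set.Icc a b, ENNReal.ofReal (W u) with hZ
  have hms : MeasurableSet (Set.Icc a b ∩ Set.Iic 64) := measurableSet_Icc.inter measurableSet_Iic
  have hsub : ∀ q : ENNReal, ∫⁻ u in Set.Icc a b ∩ Set.Iic 64, q * ENNReal.ofReal (W u)
      ≤ ∫⁻ u in Set.Icc a b, q * ENNReal.ofReal (W u) :=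
    fun q => lintegral_mono_set Set.inter_subset_left
  by_cases hshort : b - a ≤ 1 / Λ
  · -- The whole interval is already short enough.
    calc _ ≤ ∫⁻ u in Set.Icc a b ∩ Set.Iic 64,
          ENNReal.ofReal (27000 * (Λ ^ 2 / p ^ 2)) * ENNReal.ofReal (W u) := by
          refine setLIntegral_mono' hms fun u hu => ?_
          gcongr
          have h1 : |u - 1| ≤ 1 / Λ := abs_le.2 ⟨by linarith [hu.1.1], by linarith [hu.1.2]⟩
          have h2 : (u - 1) ^ 2 ≤ (1 / Λ) ^ 2 := by rw [← sq_abs]; gcongr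
          rw [div_pow, one_pow] at h2
          nlinarith [(by positivity : 0 ≤ Λ ^ 2 / p ^ 2)]
      _ ≤ _ := hsub _
      _ = _ := lintegral_const_mul' _ _ ENNReal.ofReal_ne_top
  -- The mass of an interval of length `1 / (2 Λ)` next to `1` bounds `Z` from below.
  have hZlow : ENNReal.ofReal (c / (6 * Λ)) ≤ Z := by
    have hJ : ∃ s : ℝ, Set.Icc s (s + 1 / (2 * Λ)) ⊆ Set.Icc a b ∧
        ∀ v ∈ Set.Icc s (s + 1 / (2 * Λ)), |v - 1| ≤ 1 / (2 * Λ) := by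
      have h2 : 1 / Λ = 1 / (2 * Λ) + 1 / (2 * Λ) := by field_simp; norm_num
      by_cases hr : 1 + 1 / (2 * Λ) ≤ b
      · exact ⟨1, Set.Icc_subset_Icc ha1 hr, fun v hv => abs_le.2
          ⟨by linarith [hv.1, (by positivity : 0 < 1 / (2 * Λ))], by linarith [hv.2]⟩⟩
      · refine ⟨1 - 1 / (2 * Λ), Set.Icc_subset_Icc (by linarith) (by linarith),
          fun v hv => abs_le.2
          ⟨by linarith [hv.1], by linarith [hv.2, (by positivity : 0 < 1 / (2 * Λ))]⟩⟩
    obtain ⟨s, hs1, hs2⟩ := hJ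
    calc ENNReal.ofReal (c / (6 * Λ))
        = ∫⁻ _ in Set.Icc s (s + 1 / (2 * Λ)), ENNReal.ofReal (c / 3) := by
          rw [setLIntegral_const, Real.volume_Icc, ← ENNReal.ofReal_mul (by positivity)]
          congr 1
          field_simp
          ring
      _ ≤ ∫⁻ v in Set.Icc s (s + 1 / (2 * Λ)), ENNReal.ofReal (W v) := by
          refine setLIntegral_mono' measurableSet_Icc fun v hv => ENNReal.ofReal_le_ofReal ?_
          have hvd := hs2 v hv
          have hη : 1 / (2 * Λ) ≤ 1 / 2 := by
            apply one_div_le_one_div_of_le <;> linarith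
          have h1 := neg_two_mul_sq_le_log_sub (hvd.trans hη)
          have h2 := (abs_le.1 (he v (hs1 hv))).1
          have h3 : Λ * |v - 1| ≤ 1 / 2 := by
            calc Λ * |v - 1| ≤ Λ * (1 / (2 * Λ)) := by gcongr
              _ = 1 / 2 := by field_simp
          have h4 : p * (2 * (v - 1) ^ 2) ≤ 1 / 2 := by
            have : (v - 1) ^ 2 ≤ (1 / (2 * Λ)) ^ 2 := by rw [← sq_abs]; gcongr
            calc p * (2 * (v - 1) ^ 2) ≤ Λ ^ 2 * (2 * (1 / (2 * Λ)) ^ 2) := by gcongr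
              _ = 1 / 2 := by field_simp
          rw [hW v (hs1 hv)]
          have h5 : Real.exp (-1) ≤ Real.exp (p * Real.log v - p * (v - 1) + e v) := by
            apply Real.exp_le_exp.2
            nlinarith [mul_le_mul_of_nonneg_left h1 hp.le]
          have h6 : (1 : ℝ) / 3 ≤ Real.exp (-1) := by
            rw [Real.exp_neg, ← one_div]
            exact one_div_le_one_div_of_le (Real.exp_pos _) (by linarith [Real.exp_one_lt_d9])
          calc c / 3 = c * (1 / 3) := by ring
            _ ≤ _ := by gcongr; exact h6.trans h5
      _ ≤ Z := lintegral_mono_set hs1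
  set ρ : ℝ := 162 * Λ / p with hρ
  calc _ ≤ ∫⁻ u in Set.Icc a b ∩ Set.Iic 64, (ENNReal.ofReal (ρ ^ 2) * ENNReal.ofReal (W u)
        + ENNReal.ofReal c * ENNReal.ofReal ((u - 1) ^ 2 * Real.exp (-Λ * |u - 1|))) := by
        refine setLIntegral_mono' hms fun u hu => ?_
        have hu0 : 0 < u := ha.trans_le hu.1.1
        by_cases hcase : |u - 1| ≤ ρ
        · refine le_add_right ?_
          gcongr ENNReal.ofReal ?_ * _
          rw [← sq_abs]
          gcongr
        · refine le_add_left ?_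
          rw [← ENNReal.ofReal_mul (by positivity), ← ENNReal.ofReal_mul hc.le]
          apply ENNReal.ofReal_le_ofReal
          rw [hW u hu.1, mul_left_comm]
          gcongr
          have h1 := sq_sub_one_div_le_sub_one_sub_log hu0 hu.2
          have h2 := (abs_le.1 (he u hu.1)).2
          -- Beyond `ρ` the quadratic decay beats twice the Lipschitz perturbation.
          have h3 : 2 * Λ * |u - 1| ≤ p * ((u - 1) ^ 2 / 81) := by
            have h4 : 162 * Λ ≤ p * |u - 1| := by
              have := (not_le.1 hcase).le
              rw [hρ, div_le_iff₀ hp] at this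
              linarith
            rw [← sq_abs (u - 1)]
            nlinarith [mul_le_mul_of_nonneg_right h4 (abs_nonneg (u - 1))]
          nlinarith [mul_le_mul_of_nonneg_left h1 hp.le]
    _ = (∫⁻ u in Set.Icc a b ∩ Set.Iic 64, ENNReal.ofReal (ρ ^ 2) * ENNReal.ofReal (W u))
        + ∫⁻ u in Set.Icc a b ∩ Set.Iic 64,
          ENNReal.ofReal c * ENNReal.ofReal ((u - 1) ^ 2 * Real.exp (-Λ * |u - 1|)) :=
        lintegral_add_right _ (by fun_prop)
    _ ≤ ENNReal.ofReal (ρ ^ 2) * Z + ENNReal.ofReal (504 / Λ ^ 2) * Z := by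
        gcongr
        · refine (hsub _).trans_eq ?_
          exact lintegral_const_mul' _ _ ENNReal.ofReal_ne_top
        · rw [lintegral_const_mul' _ _ ENNReal.ofReal_ne_top]
          calc _ ≤ ENNReal.ofReal c * ENNReal.ofReal (84 / Λ ^ 3) := by
                gcongr
                exact (setLIntegral_le_lintegral _ _).trans (lintegral_sq_mul_exp_neg_abs_le hΛ0)
            _ = ENNReal.ofReal (504 / Λ ^ 2) * ENNReal.ofReal (c / (6 * Λ)) := by
                rw [← ENNReal.ofReal_mul hc.le, ← ENNReal.ofReal_mul (by positivity)]
                congr 1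
                field_simp
                norm_num
            _ ≤ _ := by gcongr
    _ = ENNReal.ofReal (ρ ^ 2 + 504 / Λ ^ 2) * Z := by
        rw [← add_mul, ENNReal.ofReal_add (by positivity) (by positivity)]
    _ ≤ _ := by
        gcongr
        have h1 : ρ ^ 2 = 26244 * (Λ ^ 2 / p ^ 2) := by rw [hρ]; field_simp; norm_num
        have h2 : 504 / Λ ^ 2 = 504 * (1 / Λ ^ 2) := by ring
        rw [h1, h2]
        nlinarith

/-! ### The posterior of the rescaled precision -/

/-- The unnormalised density `u ^ p * E[exp(-u D / 2)]`. With `D = ‖X - y‖² / σ_t²` and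
`p = (d - α) / 2` it describes, for given `y`, the posterior of the precision in units of its true
value, `u = σ_t² / σ²`. -/
noncomputable def precisionDensity {Ω : Type*} [MeasurableSpace Ω] (P : Measure Ω)
    (D : Ω → ℝ) (p u : ℝ) : ℝ :=
  u ^ p * ∫ ω, Real.exp (-(u / 2) * D ω) ∂P

section Density

variable {Ω : Type*} [MeasurableSpace Ω] {P : Measure Ω} [IsProbabilityMeasure P]

/-- A large value `u` of the precision is compared with the values in `[u / 4, u / 2]`. -/
theorem ofReal_precisionDensity_le_of_exp_le {D : Ω → ℝ} (hD : Measurable D) (hD0 : ∀ ω, 0 ≤ D ω)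
    {a b p u F : ℝ} (hp : 0 ≤ p) (ha1 : a ≤ 1) (hu4 : 4 ≤ u) (hub : u ≤ b)
    (hF : ∀ᵐ ω ∂P, Real.exp (-(u / 4) * D ω) ≤ F) :
    ENNReal.ofReal (precisionDensity P D p u)
      ≤ ENNReal.ofReal (4 ^ (p + 1) / u * F)
        * ∫⁻ v in Set.Icc a b, ENNReal.ofReal (precisionDensity P D p v) := by
  have hu : 0 < u := by linarith
  have hF0 : 0 ≤ F := by
    obtain ⟨ω, hω⟩ := hF.exists
    exact (Real.exp_pos _).le.trans hω
  have hint : ∀ v : ℝ, 0 ≤ v → Integrable (fun ω => Real.exp (-(v / 2) * D ω)) P := fun v hv =>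
    integrable_exp_neg_half_mul hD (M := 0)
      (Filter.Eventually.of_forall fun ω => by simpa using hD0 ω) hv
  set L := ∫ ω, Real.exp (-((u / 2) / 2) * D ω) ∂P with hL
  have hL0 : 0 ≤ L := integral_nonneg fun _ => (Real.exp_pos _).le
  have hup : precisionDensity P D p u ≤ u ^ p * (F * L) := by
    unfold precisionDensity
    gcongr
    rw [hL, ← integral_const_mul]
    refine integral_mono_ae (hint u hu.le) ((hint _ (by positivity)).const_mul _) ?_
    filter_upwards [hF] with ω hω
    have : -(u / 2) * D ω = -(u / 4) * D ω + -((u / 2) / 2) * D ω := by ring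
    rw [this, Real.exp_add]
    gcongr
  have hlow : ENNReal.ofReal ((u / 4) ^ (p + 1) * L)
      ≤ ∫⁻ v in Set.Icc a b, ENNReal.ofReal (precisionDensity P D p v) := by
    calc ENNReal.ofReal ((u / 4) ^ (p + 1) * L)
        = ∫⁻ _ in Set.Icc (u / 4) (u / 2), ENNReal.ofReal ((u / 4) ^ p * L) := by
          rw [setLIntegral_const, Real.volume_Icc, ← ENNReal.ofReal_mul (by positivity),
            Real.rpow_add_one (by positivity)]
          congr 1
          ring
      _ ≤ ∫⁻ v in Set.Icc (u / 4) (u / 2), ENNReal.ofReal (precisionDensity P D p v) := by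
          refine setLIntegral_mono' measurableSet_Icc fun v hv => ENNReal.ofReal_le_ofReal ?_
          have hv0 : 0 < v := by linarith [hv.1]
          unfold precisionDensity
          refine mul_le_mul (Real.rpow_le_rpow (by positivity) hv.1 hp) ?_ hL0 (by positivity)
          refine integral_mono (hint _ (by positivity)) (hint v hv0.le) fun ω => ?_
          apply Real.exp_le_exp.2
          nlinarith [mul_le_mul_of_nonneg_right hv.2 (hD0 ω)]
      _ ≤ _ := lintegral_mono_set (Set.Icc_subset_Icc (by linarith) (by linarith))
  calc _ ≤ ENNReal.ofReal (u ^ p * (F * L)) := ENNReal.ofReal_le_ofReal hup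
    _ = ENNReal.ofReal (4 ^ (p + 1) / u * F) * ENNReal.ofReal ((u / 4) ^ (p + 1) * L) := by
        rw [← ENNReal.ofReal_mul (by positivity)]
        congr 1
        rw [Real.div_rpow hu.le (by norm_num), Real.rpow_add_one hu.ne']
        have : (4 : ℝ) ^ (p + 1) ≠ 0 := by positivity
        field_simp
    _ ≤ _ := by gcongr

/-- If `S` is bounded below by about `-K` and has mass at least `q` close to `0`, its log-Laplace
transform is Lipschitz at `1` with constant of order `K + log (1 / q)`. -/
theorem setLIntegral_sq_sub_one_mul_precisionDensity_le {S : Ω → ℝ} (hS : Measurable S)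
    {a b p G K q : ℝ} (ha : 0 < a) (ha1 : a ≤ 1) (hb : 1 ≤ b) (hp : 0 < p) (hK : 0 ≤ K)
    (hq : 0 < q) (hq1 : q ≤ 1) (hlow : ∀ᵐ ω ∂P, -(K + 6 / b) ≤ S ω)
    (hnear : q ≤ P.real {ω | S ω ≤ 12 / b}) :
    ∫⁻ u in Set.Icc a b ∩ Set.Iic 64, ENNReal.ofReal ((u - 1) ^ 2)
        * ENNReal.ofReal (precisionDensity P (fun ω => G + S ω) p u)
      ≤ ENNReal.ofReal (27000 *
          ((1 + Real.sqrt p + |p - G / 2| + 4 * (K / 2 + 12 + Real.log q⁻¹)) ^ 2 / p ^ 2))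
        * ∫⁻ u in Set.Icc a b, ENNReal.ofReal (precisionDensity P (fun ω => G + S ω) p u) := by
  set A := K / 2 + 12 + Real.log q⁻¹ with hA
  have hb0 : 0 < b := by linarith
  have hlq : 0 ≤ Real.log q⁻¹ := Real.log_nonneg (one_le_inv₀ hq |>.2 hq1)
  have hA0 : 0 ≤ A := by positivity
  set Λ := 1 + Real.sqrt p + |p - G / 2| + 4 * A with hΛ
  have hΛ1 : 1 ≤ Λ := by
    have := Real.sqrt_nonneg p
    have := abs_nonneg (p - G / 2)
    linarith
  have hΛp : p ≤ Λ ^ 2 := by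
    rw [← Real.sqrt_le_left (by linarith)]
    have := abs_nonneg (p - G / 2)
    linarith
  set I : ℝ → ℝ := fun u => ∫ ω, Real.exp (-(u / 2) * S ω) ∂P with hI
  have hint : ∀ u : ℝ, 0 ≤ u → Integrable (fun ω => Real.exp (-(u / 2) * S ω)) P := fun u hu =>
    integrable_exp_neg_half_mul hS hlow hu
  have hIpos : ∀ u : ℝ, 0 ≤ u → 0 < I u := fun u hu => integral_exp_pos (hint u hu)
  have hc : ConvexOn ℝ (Set.Ici 0) (fun u => Real.log (I u)) :=
    convexOn_log_integral_exp_neg_half_mul hS hlow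
  have hI0 : Real.log (I 0) = 0 := by simp [hI]
  have hIlow : ∀ u ∈ Set.Icc 0 (2 * b), -A ≤ Real.log (I u) := by
    intro u hu
    rw [Real.le_log_iff_exp_le (hIpos u hu.1)]
    have h12 : -12 ≤ -(u / 2) * (12 / b) := by
      have : u / 2 * (12 / b) ≤ b * (12 / b) := by
        gcongr
        linarith [hu.2]
      have hb' : b * (12 / b) = 12 := by field_simp
      linarith
    have hms : MeasurableSet {ω | S ω ≤ 12 / b} := hS measurableSet_Iic
    calc Real.exp (-A) ≤ Real.exp (-12) * q := by
          have : q = Real.exp (-Real.log q⁻¹) := by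
            rw [Real.log_inv, neg_neg, Real.exp_log hq]
          have h2 : Real.exp (-12) * q = Real.exp (-12 + -Real.log q⁻¹) := by
            rw [Real.exp_add, ← this]
          rw [h2]
          apply Real.exp_le_exp.2
          rw [hA]
          linarith
      _ ≤ Real.exp (-12) * P.real {ω | S ω ≤ 12 / b} := by gcongr
      _ = ∫ _ in {ω | S ω ≤ 12 / b}, Real.exp (-12) ∂P := by
          rw [setIntegral_const, smul_eq_mul, mul_comm]
      _ ≤ ∫ ω in {ω | S ω ≤ 12 / b}, Real.exp (-(u / 2) * S ω) ∂P := by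
          refine setIntegral_mono_on (integrable_const _).integrableOn (hint u hu.1).integrableOn
            hms fun ω hω => Real.exp_le_exp.2 (h12.trans ?_)
          have : u / 2 * S ω ≤ u / 2 * (12 / b) :=
            mul_le_mul_of_nonneg_left hω (by linarith [hu.1])
          linarith
      _ ≤ I u := setIntegral_le_integral (hint u hu.1)
          (Filter.Eventually.of_forall fun _ => (Real.exp_pos _).le)
  have hIup : ∀ u ∈ Set.Icc 0 (2 * b), Real.log (I u) ≤ A * (1 + u) := by
    intro u hu
    rw [Real.log_le_iff_le_exp (hIpos u hu.1)]
    calc I u ≤ ∫ _, Real.exp (u * (K / 2) + 6) ∂P := by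
          refine integral_mono_ae (hint u hu.1) (integrable_const _) ?_
          filter_upwards [hlow] with ω hω
          apply Real.exp_le_exp.2
          have h1 : u / 2 * (-(K + 6 / b)) ≤ u / 2 * S ω :=
            mul_le_mul_of_nonneg_left hω (by linarith [hu.1])
          have h2 : u / 2 * (6 / b) ≤ b * (6 / b) := by
            gcongr
            linarith [hu.2]
          have hb' : b * (6 / b) = 6 := by field_simp
          linarith
      _ ≤ _ := by
          rw [integral_const, probReal_univ, one_smul]
          apply Real.exp_le_exp.2
          have h1 : u * (K / 2) ≤ u * A := mul_le_mul_of_nonneg_left (by linarith) hu.1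
          linarith
  refine setLIntegral_sq_sub_one_mul_le ha ha1 hb hp hΛ1 hΛp
    (c := Real.exp (Real.log (I 1) - G / 2))
    (e := fun u => (p - G / 2) * (u - 1) + (Real.log (I u) - Real.log (I 1))) (Real.exp_pos _) ?_ ?_
  · intro u hu
    have hu0 : 0 < u := ha.trans_le hu.1
    have h1 : ∫ ω, Real.exp (-(u / 2) * (G + S ω)) ∂P
        = Real.exp (-(u / 2) * G) * Real.exp (Real.log (I u)) := by
      rw [Real.exp_log (hIpos u hu0.le), hI, ← integral_const_mul]
      simp_rw [mul_add, Real.exp_add]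
    unfold precisionDensity
    rw [h1, Real.rpow_def_of_pos hu0, ← Real.exp_add, ← Real.exp_add, ← Real.exp_add]
    ring_nf
  · intro u hu
    have h1 := abs_sub_apply_one_le_of_convexOn hb hc hI0 hIlow hIup
      (u := u) ⟨(ha.trans_le hu.1).le, hu.2⟩
    refine (abs_add_le _ _).trans ?_
    rw [abs_mul]
    have h2 : 0 ≤ (1 + Real.sqrt p) * |u - 1| := by positivity
    rw [hΛ]
    linarith

end Density

/-- The substitution `σ = σ_t / √u`. -/
theorem setLIntegral_noiseWeight_mul_eq {d : ℕ} (pX : Measure (EuclideanSpace ℝ (Fin d)))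
    (α : ℝ) {σT σ0 σt : ℝ} (hT : 0 < σT) (h0 : 0 < σ0) (ht : 0 < σt)
    (y : EuclideanSpace ℝ (Fin d)) (f : ℝ → ENNReal) :
    ∫⁻ σ in Set.Icc σT σ0, ENNReal.ofReal (BlindDenoise.noiseWeight pX α y σ) * f ((σ ^ 2)⁻¹)
      = ENNReal.ofReal (σt / 2 * σt ^ (α - 3) / σt ^ d) *
        ∫⁻ u in Set.Icc ((σt / σ0) ^ 2) ((σt / σT) ^ 2),
          ENNReal.ofReal (precisionDensity pX (fun x => ‖x - y‖ ^ 2 / σt ^ 2) ((d - α) / 2) u)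
            * f (u * (σt ^ 2)⁻¹) := by
  set φ : ℝ → ℝ := fun u => σt * u ^ (-(1 / 2) : ℝ) with hφ
  have hφσ : ∀ σ : ℝ, 0 < σ → φ ((σt / σ) ^ 2) = σ := by
    intro σ hσ
    simp only [hφ]
    rw [← Real.rpow_natCast, ← Real.rpow_mul (by positivity)]
    norm_num
    rw [Real.rpow_neg_one]
    field_simp
  have hφpos : ∀ u : ℝ, 0 < u → 0 < φ u := fun u hu => by positivity
  have hφsq : ∀ u : ℝ, 0 < u → (φ u ^ 2)⁻¹ = u * (σt ^ 2)⁻¹ := by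
    intro u hu
    simp only [hφ]
    rw [mul_pow, ← Real.rpow_natCast (u ^ _), ← Real.rpow_mul hu.le,
      show (-(1 / 2) * ((2 : ℕ) : ℝ) : ℝ) = -1 by norm_num, Real.rpow_neg_one, mul_inv, inv_inv,
      mul_comm]
  have hinv : ∀ u : ℝ, 0 < u → (σt / φ u) ^ 2 = u := by
    intro u hu
    rw [div_pow, div_eq_mul_inv, hφsq u hu]
    field_simp
  have hapos : 0 < (σt / σ0) ^ 2 := by positivity
  have hinj : Set.InjOn φ (Set.Icc ((σt / σ0) ^ 2) ((σt / σT) ^ 2)) := by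
    intro u hu v hv huv
    rw [← hinv u (hapos.trans_le hu.1), huv, hinv v (hapos.trans_le hv.1)]
  have himg : Set.Icc σT σ0 = φ '' Set.Icc ((σt / σ0) ^ 2) ((σt / σT) ^ 2) := by
    ext σ
    constructor
    · intro hσ
      have hσ0 : 0 < σ := hT.trans_le hσ.1
      refine ⟨(σt / σ) ^ 2, ⟨?_, ?_⟩, hφσ σ hσ0⟩
      · have := hσ.2
        gcongr
      · have := hσ.1
        gcongr
    · rintro ⟨u, hu, rfl⟩
      have hu0 := hapos.trans_le hu.1
      have hp := hφpos u hu0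
      rw [← hinv u hu0] at hu
      constructor
      · have := (pow_le_pow_iff_left₀ (by positivity) (by positivity) two_ne_zero).1 hu.2
        rwa [div_le_div_iff_of_pos_left ht hp hT] at this
      · have := (pow_le_pow_iff_left₀ (by positivity) (by positivity) two_ne_zero).1 hu.1
        rwa [div_le_div_iff_of_pos_left ht h0 hp] at this
  have hder : ∀ u ∈ Set.Icc ((σt / σ0) ^ 2) ((σt / σT) ^ 2),
      HasDerivWithinAt φ (σt * (-(1 / 2) * u ^ (-(1 / 2) - 1 : ℝ)))
        (Set.Icc ((σt / σ0) ^ 2) ((σt / σT) ^ 2)) u := fun u hu =>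
    ((Real.hasDerivAt_rpow_const (Or.inl (hapos.trans_le hu.1).ne')).const_mul σt).hasDerivWithinAt
  rw [himg, lintegral_image_eq_lintegral_abs_deriv_mul measurableSet_Icc hder hinj,
    ← lintegral_const_mul' _ _ ENNReal.ofReal_ne_top]
  refine setLIntegral_congr_fun measurableSet_Icc fun u hu => ?_
  have hu0 := hapos.trans_le hu.1
  rw [hφsq u hu0, ← mul_assoc (ENNReal.ofReal _), ← mul_assoc (ENNReal.ofReal _),
    ← ENNReal.ofReal_mul (abs_nonneg _),
    ← ENNReal.ofReal_mul (by positivity)]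
  congr 2
  have habs : |σt * (-(1 / 2) * u ^ (-(1 / 2) - 1 : ℝ))| = σt / 2 * u ^ (-(3 / 2) : ℝ) := by
    rw [show σt * (-(1 / 2) * u ^ (-(1 / 2) - 1 : ℝ)) = -(σt / 2 * u ^ (-(1 / 2) - 1 : ℝ)) by ring,
      abs_neg, abs_of_pos (by positivity)]
    norm_num
  unfold BlindDenoise.noiseWeight BlindDenoise.powerPrior precisionDensity
  rw [hφsq u hu0, habs]
  have hexp : ∀ x : EuclideanSpace ℝ (Fin d), -(u * (σt ^ 2)⁻¹ / 2) * ‖x - y‖ ^ 2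
      = -(u / 2) * (‖x - y‖ ^ 2 / σt ^ 2) := fun x => by ring
  simp_rw [hexp]
  set J := ∫ x, Real.exp (-(u / 2) * (‖x - y‖ ^ 2 / σt ^ 2)) ∂pX
  have hpow : u ^ (-(3 / 2) : ℝ) * (φ u ^ (α - 3) / φ u ^ d)
      = σt ^ (α - 3) / σt ^ d * u ^ ((d - α) / 2) := by
    simp only [hφ]
    rw [Real.mul_rpow ht.le (by positivity), mul_pow, ← Real.rpow_mul hu0.le,
      ← Real.rpow_natCast (u ^ _), ← Real.rpow_mul hu0.le]
    have e1 : u ^ ((d - α) / 2) * u ^ (-(1 / 2) * (d : ℝ))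
        = u ^ (-(3 / 2) : ℝ) * u ^ (-(1 / 2) * (α - 3)) := by
      rw [← Real.rpow_add hu0, ← Real.rpow_add hu0]
      ring_nf
    have hne : u ^ (-(1 / 2) * (d : ℝ)) ≠ 0 := by positivity
    generalize u ^ (-(1 / 2) * (d : ℝ)) = A₁ at e1 hne ⊢
    generalize u ^ (-(1 / 2) * (α - 3)) = A₂ at e1 ⊢
    generalize u ^ (-(3 / 2) : ℝ) = A₃ at e1 ⊢
    generalize u ^ ((d - α) / 2) = A₄ at e1 ⊢
    field_simp
    linear_combination -e1
  linear_combination (σt / 2 * J) * hpow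

/-- A bound for the mean of `(u - 1)²` under the posterior of the rescaled precision
`u = σ_t² / σ²` is a bound for the mean of `|λ - λ_t|²` in units of `λ_t²`. -/
theorem lintegral_precisionPosterior_le {d : ℕ} (pX : Measure (EuclideanSpace ℝ (Fin d)))
    [IsProbabilityMeasure pX] (α : ℝ) {σT σ0 σt : ℝ} (hT : 0 < σT) (h0 : 0 < σ0) (ht : 0 < σt)
    (y : EuclideanSpace ℝ (Fin d)) {B : ENNReal}
    (hB : ∫⁻ u in Set.Icc ((σt / σ0) ^ 2) ((σt / σT) ^ 2), ENNReal.ofReal ((u - 1) ^ 2)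
          * ENNReal.ofReal (precisionDensity pX (fun x => ‖x - y‖ ^ 2 / σt ^ 2) ((d - α) / 2) u)
        ≤ B * ∫⁻ u in Set.Icc ((σt / σ0) ^ 2) ((σt / σT) ^ 2),
          ENNReal.ofReal (precisionDensity pX (fun x => ‖x - y‖ ^ 2 / σt ^ 2) ((d - α) / 2) u)) :
    ∫⁻ l, ENNReal.ofReal (|l - (σt ^ 2)⁻¹| ^ 2) ∂(BlindDenoise.precisionPosterior pX α σT σ0 y)
      ≤ ENNReal.ofReal (((σt ^ 2)⁻¹) ^ 2) * B := by
  have hm := (BlindDenoise.measurable_noiseWeight pX α y).ennreal_ofReal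
  have hZ := setLIntegral_noiseWeight_mul_eq pX α hT h0 ht y (fun _ => 1)
  have hN := setLIntegral_noiseWeight_mul_eq pX α hT h0 ht y
    (fun l => ENNReal.ofReal (|l - (σt ^ 2)⁻¹| ^ 2))
  simp only [mul_one] at hZ
  have hmass : BlindDenoise.noiseWeightMeasure pX α σT σ0 y Set.univ
      = ∫⁻ σ in Set.Icc σT σ0, ENNReal.ofReal (BlindDenoise.noiseWeight pX α y σ) := by
    unfold BlindDenoise.noiseWeightMeasure
    rw [withDensity_apply _ MeasurableSet.univ, Measure.restrict_univ]
  unfold BlindDenoise.precisionPosterior BlindDenoise.noisePosterior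
  rw [lintegral_map (by fun_prop) (by fun_prop), lintegral_smul_measure, hmass]
  unfold BlindDenoise.noiseWeightMeasure
  rw [lintegral_withDensity_eq_lintegral_mul _ hm (by fun_prop)]
  simp only [Pi.mul_apply]
  rw [hN, hZ, smul_eq_mul]
  set c := ENNReal.ofReal (σt / 2 * σt ^ (α - 3) / σt ^ d)
  set Z := ∫⁻ u in Set.Icc ((σt / σ0) ^ 2) ((σt / σT) ^ 2),
    ENNReal.ofReal (precisionDensity pX (fun x => ‖x - y‖ ^ 2 / σt ^ 2) ((d - α) / 2) u) with hZdef
  have hnum : ∫⁻ u in Set.Icc ((σt / σ0) ^ 2) ((σt / σT) ^ 2),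
      ENNReal.ofReal (precisionDensity pX (fun x => ‖x - y‖ ^ 2 / σt ^ 2) ((d - α) / 2) u)
        * ENNReal.ofReal (|u * (σt ^ 2)⁻¹ - (σt ^ 2)⁻¹| ^ 2)
      ≤ ENNReal.ofReal (((σt ^ 2)⁻¹) ^ 2) * (B * Z) := by
    refine le_trans (le_of_eq ?_) (mul_le_mul_right hB _)
    rw [← lintegral_const_mul' _ _ ENNReal.ofReal_ne_top]
    refine lintegral_congr fun u => ?_
    have hsq : ENNReal.ofReal (|u * (σt ^ 2)⁻¹ - (σt ^ 2)⁻¹| ^ 2)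
        = ENNReal.ofReal (((σt ^ 2)⁻¹) ^ 2) * ENNReal.ofReal ((u - 1) ^ 2) := by
      rw [sq_abs, ← ENNReal.ofReal_mul (by positivity)]
      congr 1
      ring
    rw [hsq]
    ring
  calc (c * Z)⁻¹ * (c * _) ≤ (c * Z)⁻¹ * (c * (ENNReal.ofReal (((σt ^ 2)⁻¹) ^ 2) * (B * Z))) := by
        gcongr
    _ = ((c * Z)⁻¹ * (c * Z)) * (ENNReal.ofReal (((σt ^ 2)⁻¹) ^ 2) * B) := by ring
    _ ≤ 1 * (ENNReal.ofReal (((σt ^ 2)⁻¹) ^ 2) * B) := by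
        gcongr
        exact ENNReal.inv_mul_le_one _
    _ = _ := one_mul _

/-! ### Covers of the support -/

theorem exists_finset_card_eq_externalCoveringNumber {E : Type*} [PseudoMetricSpace E]
    {A : Set E} (hA : TotallyBounded A) {r : ℝ} (hr : 0 < r) :
    ∃ s : Finset E, s.card = (Metric.externalCoveringNumber r.toNNReal A).toNat ∧
      ∀ x ∈ A, ∃ i ∈ s, dist x i ≤ r := by
  have hr' : r.toNNReal ≠ 0 := by simpa using hr
  obtain ⟨C₀, -, hC₀fin, hC₀⟩ := Metric.exists_finite_isCover_of_totallyBounded hr' hA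
  have : Nonempty {C : Set E // Metric.IsCover r.toNNReal A C} := ⟨⟨C₀, hC₀⟩⟩
  obtain ⟨⟨C, hC⟩, hCeq⟩ := ENat.exists_eq_iInf
    (fun C : {C : Set E // Metric.IsCover r.toNNReal A C} => (C : Set E).encard)
  have hCN : C.encard = Metric.externalCoveringNumber r.toNNReal A := by
    rw [Metric.externalCoveringNumber, iInf_subtype']
    exact hCeq
  have hCfin : C.Finite := by
    rw [← Set.encard_lt_top_iff, hCN]
    exact hC₀.externalCoveringNumber_le_encard.trans_lt hC₀fin.encard_lt_top
  refine ⟨hCfin.toFinset, ?_, fun x hx => ?_⟩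
  · rw [← hCN, hCfin.encard_eq_coe_toFinset_card]
    simp
  · have h := Metric.isCover_iff_subset_iUnion_closedBall.1 hC hx
    simp only [Set.mem_iUnion, Metric.mem_closedBall, Real.coe_toNNReal _ hr.le] at h
    obtain ⟨i, hi, hd⟩ := h
    exact ⟨i, by simpa using hi, hd⟩

/-- Only a small fraction of the mass lies in cells of a cover that are light. -/
theorem measure_forall_mem_ball_lt_le {E : Type*} [PseudoMetricSpace E] [MeasurableSpace E]
    (μ : Measure E) [IsFiniteMeasure μ] {s : Finset E} {r q : ℝ}
    (hs : ∀ᵐ x ∂μ, ∃ i ∈ s, dist x i ≤ r) :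
    μ {x | ∀ i ∈ s, dist x i ≤ r → μ.real (Metric.closedBall i r) < q}
      ≤ ENNReal.ofReal (s.card * q) := by
  set t := s.filter fun i => μ.real (Metric.closedBall i r) < q with ht
  calc μ {x | ∀ i ∈ s, dist x i ≤ r → μ.real (Metric.closedBall i r) < q}
      ≤ μ (⋃ i ∈ t, Metric.closedBall i r) := by
        refine measure_mono_ae ?_
        filter_upwards [hs] with x ⟨i, hi, hd⟩ hx
        exact Set.mem_biUnion (Finset.mem_filter.2 ⟨hi, hx i hi hd⟩ : i ∈ t) hd
    _ ≤ ∑ i ∈ t, μ (Metric.closedBall i r) := measure_biUnion_finset_le _ _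
    _ ≤ ∑ _i ∈ t, ENNReal.ofReal q := by
        refine Finset.sum_le_sum fun i hi => ?_
        rw [← ofReal_measureReal]
        exact ENNReal.ofReal_le_ofReal (Finset.mem_filter.1 hi).2.le
    _ ≤ ∑ _i ∈ s, ENNReal.ofReal q := Finset.sum_le_sum_of_subset (Finset.filter_subset _ _)
    _ = ENNReal.ofReal (s.card * q) := by
        rw [Finset.sum_const, nsmul_eq_mul, ENNReal.ofReal_mul (by positivity),
          ENNReal.ofReal_natCast]

/-! ### Bounds for a fixed signal and noise -/

variable {d : ℕ}

/-- The displacement from `x` to the signal `x₀`, in units of the noise level. -/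
noncomputable def scaledDiff (σ : ℝ) (x₀ x : EuclideanSpace ℝ (Fin d)) : EuclideanSpace ℝ (Fin d) :=
  σ⁻¹ • (x₀ - x)

theorem norm_scaledDiff_sub {σ : ℝ} (hσ : 0 < σ) (x₀ x z : EuclideanSpace ℝ (Fin d)) :
    ‖scaledDiff σ x₀ x - scaledDiff σ x₀ z‖ = dist x z / σ := by
  rw [scaledDiff, scaledDiff, ← smul_sub, sub_sub_sub_cancel_left, norm_smul, Real.norm_eq_abs,
    abs_of_pos (inv_pos.2 hσ), dist_eq_norm, norm_sub_rev, div_eq_inv_mul]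

theorem norm_scaledDiff {σ : ℝ} (hσ : 0 < σ) (x₀ x : EuclideanSpace ℝ (Fin d)) :
    ‖scaledDiff σ x₀ x‖ = dist x₀ x / σ := by
  rw [scaledDiff, norm_smul, Real.norm_eq_abs, abs_of_pos (inv_pos.2 hσ), dist_eq_norm,
    div_eq_inv_mul]

theorem norm_sub_add_smul_sq_div {σ : ℝ} (hσ : 0 < σ) (x₀ x g : EuclideanSpace ℝ (Fin d)) :
    ‖x - (x₀ + σ • g)‖ ^ 2 / σ ^ 2 = ‖scaledDiff σ x₀ x + g‖ ^ 2 := by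
  have h : x - (x₀ + σ • g) = -(σ • (scaledDiff σ x₀ x + g)) := by
    rw [scaledDiff, smul_add, smul_smul, mul_inv_cancel₀ hσ.ne', one_smul]
    abel
  rw [h, norm_neg, norm_smul, Real.norm_eq_abs, abs_of_pos hσ, mul_pow]
  field_simp

theorem norm_sq_le_two_mul_add {E : Type*} [SeminormedAddCommGroup E] (v w : E) :
    ‖v‖ ^ 2 ≤ 2 * ‖w‖ ^ 2 + 2 * ‖v - w‖ ^ 2 := by
  have h : ‖v‖ ≤ ‖w‖ + ‖v - w‖ := by
    simpa using norm_add_le w (v - w)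
  nlinarith [norm_nonneg v, norm_nonneg w, norm_nonneg (v - w), sq_nonneg (‖w‖ - ‖v - w‖)]

/-- A vector within `r` of one of the centres `c i` may be replaced by the nearest centre, at the
cost of half of the exponent. -/
theorem exp_neg_norm_sq_le_sum {E : Type*} [SeminormedAddCommGroup E] {ι : Type*} {s : Finset ι}
    {c : ι → E} {v : E} {u r : ℝ} (hu : 0 ≤ u) (hur : u * r ^ 2 ≤ 1)
    (h : ∃ i ∈ s, ‖c i - v‖ ≤ r) :
    Real.exp (-(u / 4) * ‖v‖ ^ 2) ≤ 2 * ∑ i ∈ s, Real.exp (-(u / 8) * ‖c i‖ ^ 2) := by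
  obtain ⟨i, hi, hd⟩ := h
  have h1 := norm_sq_le_two_mul_add (c i) v
  have h2 : ‖c i - v‖ ^ 2 ≤ r ^ 2 := by gcongr
  have h3 : Real.exp (1 / 4) ≤ 2 := by
    have := Real.exp_bound' (x := 1 / 4) (by norm_num) (by norm_num) (n := 1) (by norm_num)
    norm_num at this
    linarith
  calc Real.exp (-(u / 4) * ‖v‖ ^ 2) ≤ Real.exp (1 / 4 + -(u / 8) * ‖c i‖ ^ 2) := by
        apply Real.exp_le_exp.2
        nlinarith [mul_le_mul_of_nonneg_left h1 hu, mul_le_mul_of_nonneg_left h2 hu]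
    _ = Real.exp (1 / 4) * Real.exp (-(u / 8) * ‖c i‖ ^ 2) := Real.exp_add _ _
    _ ≤ 2 * ∑ i ∈ s, Real.exp (-(u / 8) * ‖c i‖ ^ 2) := by
        gcongr
        exact Finset.single_le_sum (f := fun i => Real.exp (-(u / 8) * ‖c i‖ ^ 2))
          (fun i _ => (Real.exp_pos _).le) hi

/-- A bound, for given signal `x₀` and noise `g`, for the contribution of the values `u > 64` to the
posterior mean of `(u - 1)²`; the sum runs over the centres of a cover of the support. -/
noncomputable def precisionTail (s : Finset (EuclideanSpace ℝ (Fin d))) (σ p : ℝ)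
    (x₀ g : EuclideanSpace ℝ (Fin d)) : ENNReal :=
  ∫⁻ u in Set.Ioi (64 : ℝ), ENNReal.ofReal (8 * 4 ^ p * u) *
    ∑ i ∈ s, ENNReal.ofReal (Real.exp (-(u / 8) * ‖scaledDiff σ x₀ i + g‖ ^ 2))

theorem setLIntegral_Ioi_precisionDensity_le (pX : Measure (EuclideanSpace ℝ (Fin d)))
    [IsProbabilityMeasure pX] {s : Finset (EuclideanSpace ℝ (Fin d))} {σ r a b p : ℝ} (hσ : 0 < σ)
    (hp : 0 ≤ p) (ha1 : a ≤ 1) (hrb : b * (r / σ) ^ 2 ≤ 1)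
    (hs : ∀ᵐ x ∂pX, ∃ i ∈ s, dist x i ≤ r) (x₀ g : EuclideanSpace ℝ (Fin d)) :
    ∫⁻ u in Set.Icc a b ∩ Set.Ioi 64, ENNReal.ofReal ((u - 1) ^ 2)
        * ENNReal.ofReal (precisionDensity pX (fun x => ‖scaledDiff σ x₀ x + g‖ ^ 2) p u)
      ≤ precisionTail s σ p x₀ g * ∫⁻ u in Set.Icc a b,
          ENNReal.ofReal (precisionDensity pX (fun x => ‖scaledDiff σ x₀ x + g‖ ^ 2) p u) := by
  set Z := ∫⁻ u in Set.Icc a b,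
    ENNReal.ofReal (precisionDensity pX (fun x => ‖scaledDiff σ x₀ x + g‖ ^ 2) p u)
  have hm : Measurable (fun x => ‖scaledDiff σ x₀ x + g‖ ^ 2) := by
    unfold scaledDiff
    fun_prop
  have hpt : ∀ u ∈ Set.Icc a b ∩ Set.Ioi 64, ENNReal.ofReal ((u - 1) ^ 2)
        * ENNReal.ofReal (precisionDensity pX (fun x => ‖scaledDiff σ x₀ x + g‖ ^ 2) p u)
      ≤ (ENNReal.ofReal (8 * 4 ^ p * u) *
        ∑ i ∈ s, ENNReal.ofReal (Real.exp (-(u / 8) * ‖scaledDiff σ x₀ i + g‖ ^ 2))) * Z := by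
    intro u hu
    have hu64 : (64 : ℝ) < u := hu.2
    have hu0 : 0 < u := by linarith
    set F := 2 * ∑ i ∈ s, Real.exp (-(u / 8) * ‖scaledDiff σ x₀ i + g‖ ^ 2) with hF
    have hF0 : 0 ≤ F := by positivity
    have h1 := ofReal_precisionDensity_le_of_exp_le (P := pX) hm (fun _ => sq_nonneg _) (a := a)
      (b := b) (u := u) (F := F) hp ha1 (by linarith) hu.1.2 (by
        filter_upwards [hs] with x ⟨i, hi, hd⟩
        refine exp_neg_norm_sq_le_sum (c := fun i => scaledDiff σ x₀ i + g) (r := r / σ) hu0.le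
          ((mul_le_mul_of_nonneg_right hu.1.2 (sq_nonneg _)).trans hrb) ⟨i, hi, ?_⟩
        rw [add_sub_add_right_eq_sub, norm_scaledDiff_sub hσ, dist_comm]
        gcongr)
    calc _ ≤ ENNReal.ofReal ((u - 1) ^ 2) * (ENNReal.ofReal (4 ^ (p + 1) / u * F) * Z) := by gcongr
      _ = ENNReal.ofReal ((u - 1) ^ 2 * (4 ^ (p + 1) / u * F)) * Z := by
          rw [← mul_assoc, ← ENNReal.ofReal_mul (by positivity)]
      _ ≤ ENNReal.ofReal (8 * 4 ^ p * u *
          ∑ i ∈ s, Real.exp (-(u / 8) * ‖scaledDiff σ x₀ i + g‖ ^ 2)) * Z := by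
          gcongr ENNReal.ofReal ?_ * _
          have h2 : (u - 1) ^ 2 / u ≤ u := by
            rw [div_le_iff₀ hu0]
            nlinarith
          calc (u - 1) ^ 2 * (4 ^ (p + 1) / u * F) = (u - 1) ^ 2 / u * (4 ^ (p + 1) * F) := by ring
            _ ≤ u * (4 ^ (p + 1) * F) := by gcongr
            _ = _ := by
              rw [Real.rpow_add_one (by norm_num), hF]
              ring
      _ = _ := by
          rw [ENNReal.ofReal_mul (by positivity),
            ENNReal.ofReal_sum_of_nonneg fun _ _ => (Real.exp_pos _).le]
  calc _ ≤ ∫⁻ u in Set.Icc a b ∩ Set.Ioi 64, (ENNReal.ofReal (8 * 4 ^ p * u) *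
        ∑ i ∈ s, ENNReal.ofReal (Real.exp (-(u / 8) * ‖scaledDiff σ x₀ i + g‖ ^ 2))) * Z :=
        setLIntegral_mono' (measurableSet_Icc.inter measurableSet_Ioi) hpt
    _ ≤ ∫⁻ u in Set.Ioi (64 : ℝ), (ENNReal.ofReal (8 * 4 ^ p * u) *
        ∑ i ∈ s, ENNReal.ofReal (Real.exp (-(u / 8) * ‖scaledDiff σ x₀ i + g‖ ^ 2))) * Z :=
        lintegral_mono_set Set.inter_subset_right
    _ = precisionTail s σ p x₀ g * Z := by
        rw [lintegral_mul_const _ (by fun_prop)]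
        rfl

/-- The values `u ≤ 64` when the signal lies in a heavy cell, the noise has norm `O(√d)`, and its
inner products with the displacements to the centres of the cover are not too negative. -/
theorem setLIntegral_Iic_precisionDensity_le (pX : Measure (EuclideanSpace ℝ (Fin d)))
    [IsProbabilityMeasure pX] {s : Finset (EuclideanSpace ℝ (Fin d))} {σ r a b p K q : ℝ}
    (hσ : 0 < σ) (hr : 0 ≤ r) (hp : 0 < p) (ha : 0 < a) (ha1 : a ≤ 1) (hb : 1 ≤ b) (hd : 0 < d)
    (hrb : r / σ * b * Real.sqrt d ≤ 1) (hK : 0 ≤ K) (hq : 0 < q) (hq1 : q ≤ 1)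
    (hs : ∀ᵐ x ∂pX, ∃ i ∈ s, dist x i ≤ r) {x₀ g i₀ : EuclideanSpace ℝ (Fin d)}
    (hx₀ : dist x₀ i₀ ≤ r) (hi₀ : q ≤ pX.real (Metric.closedBall i₀ r)) (hg : ‖g‖ ^ 2 ≤ 4 * d)
    (hinner : ∀ i ∈ s,
      -K ≤ ‖scaledDiff σ x₀ i‖ ^ 2 / 2 + 2 * inner ℝ (scaledDiff σ x₀ i) g) :
    ∫⁻ u in Set.Icc a b ∩ Set.Iic 64, ENNReal.ofReal ((u - 1) ^ 2)
        * ENNReal.ofReal (precisionDensity pX (fun x => ‖scaledDiff σ x₀ x + g‖ ^ 2) p u)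
      ≤ ENNReal.ofReal (27000 * ((1 + Real.sqrt p + |p - ‖g‖ ^ 2 / 2|
          + 4 * (K / 2 + 12 + Real.log q⁻¹)) ^ 2 / p ^ 2))
        * ∫⁻ u in Set.Icc a b,
          ENNReal.ofReal (precisionDensity pX (fun x => ‖scaledDiff σ x₀ x + g‖ ^ 2) p u) := by
  have hb0 : 0 < b := by linarith
  have hd1 : (1 : ℝ) ≤ d := by exact_mod_cast hd
  set ρ := r / σ with hρ
  have hρ0 : 0 ≤ ρ := by positivity
  have hsd : 1 ≤ Real.sqrt d := Real.one_le_sqrt.2 hd1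
  have hρb : ρ ≤ 1 / b := by
    rw [le_div_iff₀ hb0]
    exact (le_mul_of_one_le_right (by positivity) hsd).trans hrb
  have hb1 : 1 / b ≤ 1 := by rw [div_le_one hb0]; exact hb
  have hρ2 : ρ ^ 2 ≤ 1 / b := by nlinarith
  have hgn : ‖g‖ ≤ 2 * Real.sqrt d := by
    apply le_of_sq_le_sq _ (by positivity)
    rw [mul_pow, Real.sq_sqrt (by positivity)]
    linarith
  have hρg : ρ * ‖g‖ ≤ 2 / b := by
    rw [le_div_iff₀ hb0]
    calc ρ * ‖g‖ * b ≤ ρ * (2 * Real.sqrt d) * b := by gcongr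
      _ = 2 * (ρ * b * Real.sqrt d) := by ring
      _ ≤ 2 := by linarith
  have h6 : 6 / b = 6 * (1 / b) := by ring
  have h2 : 2 / b = 2 * (1 / b) := by ring
  have h12 : 12 / b = 12 * (1 / b) := by ring
  have hb' : 0 < 1 / b := by positivity
  have hfun : (fun x => ‖scaledDiff σ x₀ x + g‖ ^ 2) = fun x => ‖g‖ ^ 2 +
      (‖scaledDiff σ x₀ x‖ ^ 2 + 2 * inner ℝ (scaledDiff σ x₀ x) g) := by
    ext x
    rw [norm_add_sq_real]
    ring
  rw [hfun]
  refine setLIntegral_sq_sub_one_mul_precisionDensity_le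
    (S := fun x => ‖scaledDiff σ x₀ x‖ ^ 2 + 2 * inner ℝ (scaledDiff σ x₀ x) g)
    (by unfold scaledDiff; fun_prop) ha ha1 hb hp hK hq hq1 ?_ ?_
  · filter_upwards [hs] with x ⟨i, hi, hdi⟩
    have hn : ‖scaledDiff σ x₀ i - scaledDiff σ x₀ x‖ ≤ ρ := by
      rw [norm_scaledDiff_sub hσ, dist_comm, hρ]
      gcongr
    have h3 := norm_sq_le_two_mul_add (scaledDiff σ x₀ i) (scaledDiff σ x₀ x)
    have h4 : ‖scaledDiff σ x₀ i - scaledDiff σ x₀ x‖ ^ 2 ≤ ρ ^ 2 := by gcongr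
    have h5 := hinner i hi
    have h7 : inner ℝ (scaledDiff σ x₀ i) g - inner ℝ (scaledDiff σ x₀ x) g ≤ ρ * ‖g‖ := by
      rw [← inner_sub_left]
      exact (real_inner_le_norm _ _).trans (by gcongr)
    rw [h6]
    linarith
  · refine hi₀.trans (measureReal_mono fun x hx => ?_)
    have hn : ‖scaledDiff σ x₀ x‖ ≤ 2 * ρ := by
      rw [norm_scaledDiff hσ, hρ, ← mul_div_assoc]
      have := dist_triangle_right x₀ x i₀
      have hx' : dist x i₀ ≤ r := hx
      gcongr
      linarith
    have h3 : ‖scaledDiff σ x₀ x‖ ^ 2 ≤ (2 * ρ) ^ 2 := by gcongr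
    have h4 : inner ℝ (scaledDiff σ x₀ x) g ≤ 2 * (ρ * ‖g‖) := by
      rw [← mul_assoc]
      exact (real_inner_le_norm _ _).trans (by gcongr)
    rw [Set.mem_ofPred_eq, h12]
    nlinarith

/-- The posterior mean for given signal and noise. Outside the exceptional event where the signal
lies in a light cell, or the noise is too large or has an unusual inner product with some
displacement, it is bounded by the last term; on that event the middle term is at least `64²`. -/
theorem lintegral_precisionPosterior_add_smul_le (pX : Measure (EuclideanSpace ℝ (Fin d)))
    [IsProbabilityMeasure pX] {s : Finset (EuclideanSpace ℝ (Fin d))}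
    {α σT σ0 σ r K q : ℝ} (hT : 0 < σT) (hσ : σ ∈ Set.Icc σT σ0) (hr : 0 ≤ r) (hp : α < d)
    (hd : 0 < d) (hrb : r / σ * (σ / σT) ^ 2 * Real.sqrt d ≤ 1) (hK : 0 ≤ K) (hq : 0 < q)
    (hq1 : q ≤ 1) (hs : ∀ᵐ x ∂pX, ∃ i ∈ s, dist x i ≤ r) (x₀ g : EuclideanSpace ℝ (Fin d)) :
    ∫⁻ l, ENNReal.ofReal (|l - (σ ^ 2)⁻¹| ^ 2)
        ∂(BlindDenoise.precisionPosterior pX α σT σ0 (x₀ + σ • g))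
      ≤ ENNReal.ofReal (((σ ^ 2)⁻¹) ^ 2) *
        (precisionTail s σ ((d - α) / 2) x₀ g
          + (4096 * (({x | ∀ i ∈ s, dist x i ≤ r → pX.real (Metric.closedBall i r) < q}.indicator
                (fun _ => 1) x₀) + (ENNReal.ofReal ((‖g‖ ^ 2 - d) ^ 2 / d ^ 2)
              + ∑ i ∈ s, ENNReal.ofReal (Real.exp (-(1 / 4) *
                (‖scaledDiff σ x₀ i‖ ^ 2 / 2 + 2 * inner ℝ (scaledDiff σ x₀ i) g + K)))))
            + ENNReal.ofReal (27000 * ((1 + Real.sqrt ((d - α) / 2) + |(d - α) / 2 - ‖g‖ ^ 2 / 2|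
                + 4 * (K / 2 + 12 + Real.log q⁻¹)) ^ 2 / ((d - α) / 2) ^ 2)))) := by
  have hσ0 : 0 < σ := hT.trans_le hσ.1
  have h00 : 0 < σ0 := hσ0.trans_le hσ.2
  have hp0 : 0 < (d - α) / 2 := by linarith
  have hd1 : (1 : ℝ) ≤ d := by exact_mod_cast hd
  have ha : 0 < (σ / σ0) ^ 2 := by positivity
  have ha1 : (σ / σ0) ^ 2 ≤ 1 := pow_le_one₀ (by positivity) ((div_le_one h00).2 hσ.2)
  have hb : 1 ≤ (σ / σT) ^ 2 := one_le_pow₀ ((one_le_div hT).2 hσ.1)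
  have hrb2 : (σ / σT) ^ 2 * (r / σ) ^ 2 ≤ 1 := by
    have hsd : 1 ≤ Real.sqrt d := Real.one_le_sqrt.2 hd1
    have h0 : 0 ≤ r / σ := by positivity
    have h1 : r / σ * (σ / σT) ^ 2 ≤ 1 :=
      (le_mul_of_one_le_right (by positivity) hsd).trans hrb
    have h2 : r / σ ≤ 1 := (le_mul_of_one_le_right h0 hb).trans h1
    calc (σ / σT) ^ 2 * (r / σ) ^ 2 = r / σ * (σ / σT) ^ 2 * (r / σ) := by ring
      _ ≤ 1 * 1 := by gcongr
      _ = 1 := one_mul 1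
  apply lintegral_precisionPosterior_le pX α hT h00 hσ0
  simp_rw [norm_sub_add_smul_sq_div hσ0]
  set Z := ∫⁻ u in Set.Icc ((σ / σ0) ^ 2) ((σ / σT) ^ 2), ENNReal.ofReal
    (precisionDensity pX (fun x => ‖scaledDiff σ x₀ x + g‖ ^ 2) ((d - α) / 2) u) with hZ
  -- The values `u > 64` and `u ≤ 64` are treated separately.
  rw [← lintegral_inter_add_sdiff _ _ (measurableSet_Ioi (a := (64 : ℝ))), add_mul]
  gcongr
  · exact setLIntegral_Ioi_precisionDensity_le pX hσ0 hp0.le ha1 hrb2 hs x₀ g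
  · rw [Set.sdiff_eq, Set.compl_Ioi, add_mul]
    by_cases hgood : (∃ i₀ ∈ s, dist x₀ i₀ ≤ r ∧ q ≤ pX.real (Metric.closedBall i₀ r)) ∧
        ‖g‖ ^ 2 ≤ 4 * d ∧ ∀ i ∈ s,
          -K ≤ ‖scaledDiff σ x₀ i‖ ^ 2 / 2 + 2 * inner ℝ (scaledDiff σ x₀ i) g
    · obtain ⟨⟨i₀, -, h1, h2⟩, h3, h4⟩ := hgood
      exact le_add_left (setLIntegral_Iic_precisionDensity_le pX hσ0 hr hp0 ha ha1 hb hd hrb hK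
        hq hq1 hs h1 h2 h3 h4)
    · refine le_add_right ?_
      calc _ ≤ ∫⁻ u in Set.Icc ((σ / σ0) ^ 2) ((σ / σT) ^ 2) ∩ Set.Iic 64,
            4096 * ENNReal.ofReal
              (precisionDensity pX (fun x => ‖scaledDiff σ x₀ x + g‖ ^ 2) ((d - α) / 2) u) := by
            refine setLIntegral_mono' (measurableSet_Icc.inter measurableSet_Iic) fun u hu => ?_
            gcongr
            rw [ENNReal.ofReal_le_iff_le_toReal (by norm_num)]
            have h1 : 0 < u := ha.trans_le hu.1.1
            have h2 : u ≤ 64 := hu.2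
            norm_num
            nlinarith
        _ ≤ ∫⁻ u in Set.Icc ((σ / σ0) ^ 2) ((σ / σT) ^ 2), 4096 * ENNReal.ofReal
              (precisionDensity pX (fun x => ‖scaledDiff σ x₀ x + g‖ ^ 2) ((d - α) / 2) u) :=
            lintegral_mono_set Set.inter_subset_left
        _ = 4096 * 1 * Z := by
            rw [lintegral_const_mul' _ _ (by norm_num), mul_one]
        _ ≤ _ := by
            gcongr
            simp only [not_and_or, not_exists, not_le, not_forall] at hgood
            rcases hgood with h | h | ⟨i, hi, h⟩
            · refine le_add_right (le_of_eq ?_)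
              rw [Set.indicator_of_mem]
              exact fun i hi hdi => ((h i).resolve_left (not_not.2 hi)).resolve_left hdi.not_gt
            · refine le_add_left (le_add_right ?_)
              rw [ENNReal.one_le_ofReal, one_le_div (by positivity)]
              nlinarith
            · refine le_add_left (le_add_left ?_)
              refine le_trans ?_ (Finset.single_le_sum (f := fun i => ENNReal.ofReal (Real.exp
                (-(1 / 4) * (‖scaledDiff σ x₀ i‖ ^ 2 / 2 + 2 * inner ℝ (scaledDiff σ x₀ i) g + K))))
                (fun _ _ => zero_le) hi)
              rw [ENNReal.one_le_ofReal, Real.one_le_exp_iff]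
              linarith

/-! ### Averaging over the noise and the signal -/

theorem inv_sqrt_pow_le {d : ℕ} (hd : 6 ≤ d) {u : ℝ} (hu : 64 < u) :
    (Real.sqrt (1 + 2 * (u / 8)))⁻¹ ^ d ≤ 2 ^ 18 * (1 / 4) ^ d * (u ^ 3)⁻¹ := by
  have hu0 : 0 < u := by linarith
  set w := (Real.sqrt (1 + 2 * (u / 8)))⁻¹ with hw
  have hw0 : 0 ≤ w := by positivity
  have hw4 : w ≤ 1 / 4 := by
    rw [hw, ← one_div]
    apply one_div_le_one_div_of_le (by norm_num)
    apply Real.le_sqrt_of_sq_le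
    linarith
  have hw2 : w ^ 2 ≤ 4 / u := by
    rw [hw, inv_pow, Real.sq_sqrt (by positivity), ← one_div, div_le_div_iff₀ (by positivity) hu0]
    linarith
  obtain ⟨n, rfl⟩ := Nat.exists_eq_add_of_le hd
  calc w ^ (6 + n) = (w ^ 2) ^ 3 * w ^ n := by ring
    _ ≤ (4 / u) ^ 3 * (1 / 4) ^ n := by gcongr
    _ = _ := by
      rw [pow_add]
      field_simp
      norm_num

/-- The factor `4 ^ p` in `precisionTail`, about `2 ^ d`, is beaten by the Gaussian average, which
is at most `(u / 4) ^ (-d / 2) ≤ 4 ^ (-d)` for `u ≥ 64`; six of the `d` factors are kept to make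
the integral over `u` converge. -/
theorem lintegral_precisionTail_le (hd : 6 ≤ d) (s : Finset (EuclideanSpace ℝ (Fin d)))
    (σ p : ℝ) (x₀ : EuclideanSpace ℝ (Fin d)) :
    ∫⁻ g, precisionTail s σ p x₀ g ∂(stdGaussian (EuclideanSpace ℝ (Fin d)))
      ≤ ENNReal.ofReal (2 ^ 15 * 4 ^ p * s.card * (1 / 4) ^ d) := by
  unfold precisionTail
  rw [lintegral_lintegral_swap (by fun_prop)]
  set c : ℝ := 8 * 4 ^ p * s.card * (2 ^ 18 * (1 / 4) ^ d) with hc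
  have hc0 : 0 ≤ c := by positivity
  calc _ ≤ ∫⁻ u in Set.Ioi (64 : ℝ), ENNReal.ofReal (c * u ^ (-2 : ℝ)) := by
        refine setLIntegral_mono' measurableSet_Ioi fun u hu => ?_
        have hu64 : (64 : ℝ) < u := hu
        have hu0 : 0 < u := by linarith
        rw [lintegral_const_mul _ (by fun_prop), lintegral_finsetSum _ (fun i _ => by fun_prop)]
        calc _ ≤ ENNReal.ofReal (8 * 4 ^ p * u)
              * ∑ _i ∈ s, ENNReal.ofReal ((Real.sqrt (1 + 2 * (u / 8)))⁻¹ ^ d) := by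
              gcongr with i hi
              exact lintegral_exp_neg_norm_add_sq_stdGaussian_le (by positivity) _
          _ = ENNReal.ofReal (8 * 4 ^ p * u *
              (s.card * (Real.sqrt (1 + 2 * (u / 8)))⁻¹ ^ d)) := by
              rw [Finset.sum_const, nsmul_eq_mul, ← ENNReal.ofReal_natCast,
                ← ENNReal.ofReal_mul (by positivity), ← ENNReal.ofReal_mul (by positivity)]
          _ ≤ _ := by
              apply ENNReal.ofReal_le_ofReal
              calc _ ≤ 8 * 4 ^ p * u * (s.card * (2 ^ 18 * (1 / 4) ^ d * (u ^ 3)⁻¹)) := by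
                    gcongr
                    exact inv_sqrt_pow_le hd hu64
                _ = _ := by
                    rw [show (-2 : ℝ) = -((2 : ℕ) : ℝ) by norm_num, Real.rpow_neg hu0.le,
                      Real.rpow_natCast, hc]
                    field_simp
    _ = ENNReal.ofReal (∫ u in Set.Ioi (64 : ℝ), c * u ^ (-2 : ℝ)) := by
        refine (ofReal_integral_eq_lintegral_ofReal
          ((integrableOn_Ioi_rpow_of_lt (by norm_num) (by norm_num)).const_mul c) ?_).symm
        filter_upwards [self_mem_ae_restrict measurableSet_Ioi] with u hu
        have : (0 : ℝ) < u := lt_trans (by norm_num) hu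
        positivity
    _ = _ := by
        rw [integral_const_mul, integral_Ioi_rpow_of_lt (by norm_num) (by norm_num), hc,
          show (-2 + 1 : ℝ) = -1 by norm_num, Real.rpow_neg_one]
        congr 1
        ring

/-- The exponential moment behind the union bound over the centres: with the exponent `-1 / 4`, the
quadratic term exactly compensates for the variance of the inner product. -/
theorem lintegral_exp_neg_quarter_inner_stdGaussian (v : EuclideanSpace ℝ (Fin d)) (K : ℝ) :
    ∫⁻ g, ENNReal.ofReal (Real.exp (-(1 / 4) * (‖v‖ ^ 2 / 2 + 2 * inner ℝ v g + K)))
        ∂(stdGaussian (EuclideanSpace ℝ (Fin d)))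
      = ENNReal.ofReal (Real.exp (-K / 4)) := by
  have h1 : ∀ g : EuclideanSpace ℝ (Fin d),
      ENNReal.ofReal (Real.exp (-(1 / 4) * (‖v‖ ^ 2 / 2 + 2 * inner ℝ v g + K)))
        = ENNReal.ofReal (Real.exp (-‖v‖ ^ 2 / 8 - K / 4))
          * ENNReal.ofReal (Real.exp (-0 * ‖g‖ ^ 2 + inner ℝ ((-(1 / 2) : ℝ) • v) g)) := by
    intro g
    rw [← ENNReal.ofReal_mul (by positivity), ← Real.exp_add, real_inner_smul_left]
    ring_nf
  simp_rw [h1]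
  rw [lintegral_const_mul _ (by fun_prop), lintegral_exp_quadratic_stdGaussian (by norm_num),
    ← ENNReal.ofReal_mul (by positivity), norm_smul, mul_pow, Real.norm_eq_abs, sq_abs]
  simp only [mul_zero, add_zero, Real.sqrt_one, inv_one, one_pow, one_mul, mul_one]
  rw [← Real.exp_add]
  ring_nf

/-- The bound for the posterior mean of `(u - 1)²` on the typical event as a quadratic polynomial in
`G - d`, where `G = ‖g‖²`. -/
theorem lipschitz_bound_le {d : ℝ} {α A G : ℝ} (hd : 0 < d) (hα : 2 * |α| ≤ d) :
    27000 * ((1 + Real.sqrt ((d - α) / 2) + |(d - α) / 2 - G / 2| + 4 * A) ^ 2 / ((d - α) / 2) ^ 2)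
      ≤ 1728000 / d ^ 2 * (1 + d + α ^ 2 + 16 * A ^ 2) + 1728000 / d ^ 2 * (G - d) ^ 2 := by
  have hα' := abs_le.1 (by linarith : |α| ≤ d / 2)
  set p := (d - α) / 2 with hp
  have hp4 : d / 4 ≤ p := by rw [hp]; linarith [hα'.2]
  have hpd : p ≤ d := by rw [hp]; linarith [hα'.1]
  have hp0 : 0 < p := by linarith
  have h1 : (1 + Real.sqrt p + |p - G / 2| + 4 * A) ^ 2
      ≤ 4 * (1 + d + α ^ 2 + 16 * A ^ 2 + (G - d) ^ 2) := by
    have hs := Real.sq_sqrt hp0.le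
    have ha := sq_abs (p - G / 2)
    have h2 : (p - G / 2) ^ 2 ≤ (G - d) ^ 2 + α ^ 2 := by
      have : p - G / 2 = -((G - d) + α) / 2 := by rw [hp]; ring
      rw [this]
      nlinarith [sq_nonneg (G - d - α), sq_nonneg (G - d), sq_nonneg α]
    have h3 : ∀ a b c e : ℝ, (a + b + c + e) ^ 2 ≤ 4 * (a ^ 2 + b ^ 2 + c ^ 2 + e ^ 2) := by
      intro a b c e
      nlinarith [sq_nonneg (a - b), sq_nonneg (a - c), sq_nonneg (a - e), sq_nonneg (b - c),
        sq_nonneg (b - e), sq_nonneg (c - e)]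
    refine (h3 _ _ _ _).trans ?_
    nlinarith
  calc _ ≤ 27000 * (4 * (1 + d + α ^ 2 + 16 * A ^ 2 + (G - d) ^ 2) / (d / 4) ^ 2) := by gcongr
    _ = _ := by
      field_simp
      ring

theorem lintegral_noisyLaw_le (pX : Measure (EuclideanSpace ℝ (Fin d))) (σ : ℝ)
    (F : EuclideanSpace ℝ (Fin d) → ENNReal) :
    ∫⁻ y, F y ∂(BlindDenoise.noisyLaw pX σ)
      ≤ ∫⁻ x₀, ∫⁻ g, F (x₀ + σ • g) ∂(stdGaussian (EuclideanSpace ℝ (Fin d))) ∂pX := by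
  unfold BlindDenoise.noisyLaw Measure.conv
  refine (lintegral_map_le _ _).trans ((lintegral_prod_le _).trans (lintegral_mono fun x₀ => ?_))
  exact lintegral_map_le _ _

/-- The mean squared error of the posterior for any cover of the support by `s.card` balls of
radius `r`, with `q` the threshold for light cells and `K` the threshold for inner products. -/
theorem lintegral_precisionPosterior_noisyLaw_le (pX : Measure (EuclideanSpace ℝ (Fin d)))
    [IsProbabilityMeasure pX] {s : Finset (EuclideanSpace ℝ (Fin d))}
    {α σT σ0 σ r K q : ℝ} (hT : 0 < σT) (hσ : σ ∈ Set.Icc σT σ0) (hr : 0 ≤ r)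
    (hα : 2 * |α| ≤ d) (hd : 6 ≤ d) (hrb : r / σ * (σ / σT) ^ 2 * Real.sqrt d ≤ 1) (hK : 0 ≤ K)
    (hq : 0 < q) (hq1 : q ≤ 1) (hs : ∀ᵐ x ∂pX, ∃ i ∈ s, dist x i ≤ r) :
    ∫⁻ y, ∫⁻ l, ENNReal.ofReal (|l - (σ ^ 2)⁻¹| ^ 2)
        ∂(BlindDenoise.precisionPosterior pX α σT σ0 y) ∂(BlindDenoise.noisyLaw pX σ)
      ≤ ENNReal.ofReal (((σ ^ 2)⁻¹) ^ 2 * (2 ^ 15 * 4 ^ ((d - α) / 2) * s.card * (1 / 4) ^ d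
          + (4096 * (s.card * q + (128 / d + s.card * Real.exp (-K / 4)))
            + 1728000 / (d : ℝ) ^ 2 *
              (1 + 129 * d + α ^ 2 + 16 * (K / 2 + 12 + Real.log q⁻¹) ^ 2)))) := by
  have hd0 : 0 < d := by omega
  have hd' : (0 : ℝ) < d := by exact_mod_cast hd0
  set A := K / 2 + 12 + Real.log q⁻¹ with hA
  set γ := stdGaussian (EuclideanSpace ℝ (Fin d)) with hγ
  have hγ1 : IsProbabilityMeasure γ := isProbabilityMeasure_stdGaussian
  set B := {x | ∀ i ∈ s, dist x i ≤ r → pX.real (Metric.closedBall i r) < q} with hB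
  have hBm : MeasurableSet B := by
    have : B = ⋂ i ∈ s, {x | dist x i ≤ r → pX.real (Metric.closedBall i r) < q} := by
      ext x
      simp [hB]
    rw [this]
    refine s.measurableSet_biInter fun i _ => ?_
    by_cases h : pX.real (Metric.closedBall i r) < q
    · simp [h]
    · have h2 : {x | dist x i ≤ r → pX.real (Metric.closedBall i r) < q}
          = (Metric.closedBall i r)ᶜ := by
        ext x
        simp [h]
      rw [h2]
      exact Metric.isClosed_closedBall.measurableSet.compl
  have hmom : ∀ c : ℝ, 0 ≤ c → ∫⁻ g, ENNReal.ofReal (c * (‖g‖ ^ 2 - d) ^ 2) ∂γ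
      ≤ ENNReal.ofReal (c * (128 * d)) := by
    intro c hc
    simp_rw [ENNReal.ofReal_mul hc]
    rw [lintegral_const_mul _ (by fun_prop)]
    gcongr
    exact lintegral_norm_sq_sub_dim_sq_stdGaussian_le hd0
  have hg : ∀ x₀ : EuclideanSpace ℝ (Fin d), ∫⁻ g, ∫⁻ l, ENNReal.ofReal (|l - (σ ^ 2)⁻¹| ^ 2)
        ∂(BlindDenoise.precisionPosterior pX α σT σ0 (x₀ + σ • g)) ∂γ
      ≤ ENNReal.ofReal (((σ ^ 2)⁻¹) ^ 2) *
        (ENNReal.ofReal (2 ^ 15 * 4 ^ ((d - α) / 2) * s.card * (1 / 4) ^ d)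
          + (4096 * (B.indicator (fun _ => 1) x₀ + (ENNReal.ofReal (128 / d)
              + ENNReal.ofReal (s.card * Real.exp (-K / 4))))
            + ENNReal.ofReal (1728000 / (d : ℝ) ^ 2 * (1 + 129 * d + α ^ 2 + 16 * A ^ 2)))) := by
    intro x₀
    refine (lintegral_mono fun g => lintegral_precisionPosterior_add_smul_le pX hT hσ hr
      (by linarith [le_abs_self α, abs_nonneg α] : α < d) hd0 hrb hK hq hq1 hs x₀ g).trans ?_
    rw [lintegral_const_mul' _ _ ENNReal.ofReal_ne_top, lintegral_add_right _ (by fun_prop),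
      lintegral_add_left (by fun_prop), lintegral_const_mul' _ _ (by norm_num),
      lintegral_add_left (by fun_prop), lintegral_add_left (by fun_prop),
      lintegral_finsetSum _ (fun i _ => by fun_prop)]
    gcongr
    · exact lintegral_precisionTail_le hd s σ _ x₀
    · rw [lintegral_const, measure_univ, mul_one]
    · have h1 := hmom (1 / (d : ℝ) ^ 2) (by positivity)
      have h2 : 1 / (d : ℝ) ^ 2 * (128 * d) = 128 / d := by field_simp
      rw [h2] at h1
      refine le_trans (le_of_eq ?_) h1
      refine lintegral_congr fun g => ?_
      rw [one_div_mul_eq_div]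
    · rw [Finset.sum_congr rfl fun i _ =>
          lintegral_exp_neg_quarter_inner_stdGaussian (scaledDiff σ x₀ i) K,
        Finset.sum_const, nsmul_eq_mul, ENNReal.ofReal_mul (by positivity), ENNReal.ofReal_natCast]
    · calc _ ≤ ∫⁻ g, (ENNReal.ofReal (1728000 / (d : ℝ) ^ 2 * (1 + d + α ^ 2 + 16 * A ^ 2))
            + ENNReal.ofReal (1728000 / (d : ℝ) ^ 2 * (‖g‖ ^ 2 - d) ^ 2)) ∂γ := by
            refine lintegral_mono fun g => ?_
            rw [← ENNReal.ofReal_add (by positivity) (by positivity)]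
            exact ENNReal.ofReal_le_ofReal (lipschitz_bound_le hd' hα)
        _ ≤ ENNReal.ofReal (1728000 / (d : ℝ) ^ 2 * (1 + d + α ^ 2 + 16 * A ^ 2))
            + ENNReal.ofReal (1728000 / (d : ℝ) ^ 2 * (128 * d)) := by
            rw [lintegral_add_left (by fun_prop)]
            gcongr
            · rw [lintegral_const, measure_univ, mul_one]
            · exact hmom _ (by positivity)
        _ = _ := by
            rw [← ENNReal.ofReal_add (by positivity) (by positivity)]
            ring_nf
  refine (lintegral_noisyLaw_le pX σ _).trans ((lintegral_mono hg).trans ?_)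
  rw [lintegral_const_mul' _ _ ENNReal.ofReal_ne_top, lintegral_add_left measurable_const,
    lintegral_add_right _ measurable_const, lintegral_const_mul' _ _ (by norm_num),
    lintegral_add_right _ measurable_const, lintegral_indicator_const hBm]
  simp only [lintegral_const, measure_univ, mul_one, one_mul]
  rw [ENNReal.ofReal_mul (p := ((σ ^ 2)⁻¹) ^ 2) (by positivity),
    ENNReal.ofReal_add (by positivity) (by positivity),
    ENNReal.ofReal_add (by positivity) (by positivity),
    ENNReal.ofReal_mul (by norm_num : (0 : ℝ) ≤ 4096),
    ENNReal.ofReal_add (by positivity) (by positivity),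
    ENNReal.ofReal_add (p := 128 / (d : ℝ)) (by positivity) (by positivity)]
  gcongr
  · norm_num
  · exact measure_forall_mem_ball_lt_le pX hs

/-! ### The numerical bound -/

theorem exp_sub_one_mul_two_pow_le {d : ℕ} {k : ℝ} (hd : 0 < d) (hk : k ≤ d / 4) :
    Real.exp (k - 1) * (1 / 2) ^ d ≤ 4 / d := by
  have hd' : (0 : ℝ) < d := by exact_mod_cast hd
  have h1 : (1 / 2 : ℝ) ≤ Real.exp (-(1 / 2)) := by
    have := Real.add_one_le_exp (-(1 / 2) : ℝ)
    linarith
  calc Real.exp (k - 1) * (1 / 2) ^ d ≤ Real.exp (d / 4) * Real.exp (-(1 / 2)) ^ d := by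
        gcongr
        linarith
    _ = (Real.exp (d / 4))⁻¹ := by
        rw [← Real.exp_nat_mul, ← Real.exp_add, ← Real.exp_neg]
        ring_nf
    _ ≤ ((d : ℝ) / 4)⁻¹ := by
        gcongr
        linarith [Real.add_one_le_exp ((d : ℝ) / 4)]
    _ = 4 / d := by rw [inv_div]

/-- The error terms for the thresholds `q = 1 / (N d)` and `K = 4 log (N d)`, which make
the light cells and the union bound over the centres contribute `1 / d` each. -/
theorem error_terms_le {d : ℕ} {α k N : ℝ} (hd : 6 ≤ d) (hk1 : 1 ≤ k) (hk : k ≤ d / 4)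
    (hN : N = Real.exp (k - 1)) :
    2 ^ 15 * 4 ^ (((d : ℝ) - α) / 2) * N * (1 / 4) ^ d
        + (4096 * (N * (N * d)⁻¹ + (128 / d + N * Real.exp (-(4 * Real.log (N * d)) / 4)))
          + 1728000 / (d : ℝ) ^ 2 * (1 + 129 * d + α ^ 2
            + 16 * (4 * Real.log (N * d) / 2 + 12 + Real.log ((N * d)⁻¹)⁻¹) ^ 2))
      ≤ (2 ^ 17 * 2 ^ (-α) + 1728000 * (2500 + α ^ 2)) * (1 + Real.log d) ^ 2
          * (1 / d + k ^ 2 / d ^ 2) := by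
  have hd1 : (6 : ℝ) ≤ d := by exact_mod_cast hd
  have hd0 : (0 : ℝ) < d := by linarith
  have hN0 : 0 < N := by rw [hN]; exact Real.exp_pos _
  set ℓ := Real.log d with hℓ
  have hℓ0 : 0 ≤ ℓ := Real.log_nonneg (by linarith)
  have hlog : Real.log (N * d) = k - 1 + ℓ := by
    rw [Real.log_mul hN0.ne' hd0.ne', hN, Real.log_exp]
  have e1 : N * (N * (d : ℝ))⁻¹ = 1 / d := by field_simp
  have e2 : N * Real.exp (-(4 * Real.log (N * d)) / 4) = 1 / d := by
    rw [show -(4 * Real.log (N * d)) / 4 = -Real.log (N * d) by ring, Real.exp_neg,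
      Real.exp_log (by positivity), e1]
  have e3 : 2 ^ 15 * 4 ^ (((d : ℝ) - α) / 2) * N * (1 / 4) ^ d ≤ 2 ^ 17 * 2 ^ (-α) * (1 / d) := by
    have h4 : (4 : ℝ) ^ (((d : ℝ) - α) / 2) = 2 ^ d * 2 ^ (-α) := by
      rw [show (4 : ℝ) = 2 ^ (2 : ℝ) by norm_num, ← Real.rpow_mul (by norm_num),
        show (2 : ℝ) * ((d - α) / 2) = d + -α by ring, Real.rpow_add (by norm_num),
        Real.rpow_natCast]
    have h5 : (2 : ℝ) ^ d * (1 / 4) ^ d = (1 / 2) ^ d := by rw [← mul_pow]; norm_num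
    calc _ = 2 ^ 15 * 2 ^ (-α) * (N * (2 ^ d * (1 / 4) ^ d)) := by rw [h4]; ring
      _ ≤ 2 ^ 15 * 2 ^ (-α) * (4 / d) := by
        rw [h5, hN]
        gcongr
        exact exp_sub_one_mul_two_pow_le (by omega) hk
      _ = _ := by ring
  have hA0 : 0 ≤ 4 * (k - 1 + ℓ) / 2 + 12 + (k - 1 + ℓ) := by linarith
  have hA : (4 * (k - 1 + ℓ) / 2 + 12 + (k - 1 + ℓ)) ^ 2 ≤ 144 * (k ^ 2 * (1 + ℓ) ^ 2) := by
    have : 4 * (k - 1 + ℓ) / 2 + 12 + (k - 1 + ℓ) ≤ 12 * (k * (1 + ℓ)) := by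
      nlinarith [mul_nonneg (sub_nonneg.2 hk1) hℓ0]
    calc _ ≤ (12 * (k * (1 + ℓ))) ^ 2 := by gcongr
      _ = _ := by ring
  rw [e1, e2, inv_inv, hlog]
  have h7 : 1 ≤ (1 + ℓ) ^ 2 := one_le_pow₀ (by linarith)
  have hQ : 0 ≤ k ^ 2 / (d : ℝ) ^ 2 := by positivity
  have hR : 0 ≤ 1 / (d : ℝ) := by positivity
  set T : ℝ := 2 ^ 17 * 2 ^ (-α) with hT
  have hT0 : 0 ≤ T := by positivity
  have h8 : 1728000 / (d : ℝ) ^ 2 * (1 + 129 * d + α ^ 2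
      + 16 * (4 * (k - 1 + ℓ) / 2 + 12 + (k - 1 + ℓ)) ^ 2)
      ≤ 1728000 * ((130 + α ^ 2) * (1 / d) + 2304 * ((1 + ℓ) ^ 2 * (k ^ 2 / d ^ 2))) := by
    calc _ ≤ 1728000 / (d : ℝ) ^ 2 * ((130 + α ^ 2) * d + 16 * (144 * (k ^ 2 * (1 + ℓ) ^ 2))) := by
          gcongr
          nlinarith [mul_nonneg (sq_nonneg α) (by linarith : 0 ≤ (d : ℝ) - 1)]
      _ = _ := by
          field_simp
          ring
  calc _ ≤ T * (1 / d) + (4096 * (1 / d + (128 / d + 1 / d))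
        + 1728000 * ((130 + α ^ 2) * (1 / d) + 2304 * ((1 + ℓ) ^ 2 * (k ^ 2 / d ^ 2)))) := by
        gcongr
    _ = (T + 532480 + 1728000 * (130 + α ^ 2)) * (1 / d)
        + 1728000 * 2304 * ((1 + ℓ) ^ 2 * (k ^ 2 / d ^ 2)) := by ring
    _ ≤ (T + 1728000 * (2500 + α ^ 2)) * ((1 + ℓ) ^ 2 * (1 / d))
        + (T + 1728000 * (2500 + α ^ 2)) * ((1 + ℓ) ^ 2 * (k ^ 2 / d ^ 2)) := by
        gcongr ?_ * ?_ + ?_ * _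
        · nlinarith [sq_nonneg α]
        · exact le_mul_of_one_le_left hR h7
        · nlinarith [sq_nonneg α]
    _ = _ := by ring

end BlindDenoise

theorem mainTheorem4 (α : ℝ) :
    ∃ (C : ℝ) (m : ℕ), 0 < C ∧
      ∀ (d : ℕ) (pX : Measure (EuclideanSpace ℝ (Fin d))) (R σT σ0 σt k lamt : ℝ),
        IsProbabilityMeasure pX →
        0 < R → pX.support ⊆ Metric.closedBall 0 R →
        0 < σT → σT < σ0 → σt ∈ Set.Icc σT σ0 →
        k = BlindDenoise.intrinsicDim pX (BlindDenoise.coverScale d σT σ0) →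
        C * (1 + Real.log d) ^ m * k ^ 2 ≤ d →
        lamt = (σt ^ 2)⁻¹ →
        ∫⁻ y, ∫⁻ l, ENNReal.ofReal (|l - lamt| ^ 2)
            ∂(BlindDenoise.precisionPosterior pX α σT σ0 y) ∂(BlindDenoise.noisyLaw pX σt)
          ≤ ENNReal.ofReal
              (C * (1 + Real.log d) ^ m * (lamt ^ 2 * (1 / (d : ℝ) + k ^ 2 / (d : ℝ) ^ 2))) := by
  set C₀ : ℝ := 2 ^ 17 * 2 ^ (-α) + 1728000 * (2500 + α ^ 2) with hC₀
  have hC₀0 : 1728000 * (2500 + α ^ 2) ≤ C₀ := by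
    rw [hC₀]
    exact le_add_of_nonneg_left (by positivity)
  have hC6 : 6 ≤ C₀ := by nlinarith [sq_nonneg α]
  have hCα : 2 * |α| ≤ C₀ := by nlinarith [sq_nonneg (|α| - 1), sq_abs α]
  refine ⟨C₀, 2, by linarith, ?_⟩
  intro d pX R σT σ0 σt k lamt hprob hR hsupp hT hT0 hσt hk hA2 hlam
  have hσ0 : 0 < σ0 := hT.trans hT0
  have hσtpos : 0 < σt := hT.trans_le hσt.1
  have hk1 : 1 ≤ k := by
    rw [hk]
    exact le_add_of_nonneg_right (Real.log_natCast_nonneg _)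
  have hℓ : 0 ≤ Real.log d := Real.log_natCast_nonneg _
  have hkd : C₀ * k ^ 2 ≤ d := by
    refine le_trans ?_ hA2
    gcongr
    exact le_mul_of_one_le_right (by linarith) (one_le_pow₀ (by linarith))
  have hC₀d : C₀ ≤ d := (le_mul_of_one_le_right (by linarith) (one_le_pow₀ hk1)).trans hkd
  have hd : 6 ≤ d := by
    have : (6 : ℝ) ≤ d := hC6.trans hC₀d
    exact_mod_cast this
  have hd0 : (0 : ℝ) < d := by linarith
  have hk4 : k ≤ d / 4 := by nlinarith
  have hrpos : 0 < BlindDenoise.coverScale d σT σ0 := by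
    unfold BlindDenoise.coverScale
    positivity
  obtain ⟨s, hcard, hcov⟩ := BlindDenoise.exists_finset_card_eq_externalCoveringNumber
    ((isCompact_closedBall _ _).totallyBounded.subset hsupp) hrpos
  have hs : ∀ᵐ x ∂pX, ∃ i ∈ s, dist x i ≤ BlindDenoise.coverScale d σT σ0 := by
    filter_upwards [Measure.support_mem_ae] with x hx using hcov x hx
  have hspos : 0 < s.card := by
    obtain ⟨x, i, hi, -⟩ := hs.exists
    exact Finset.card_pos.2 ⟨i, hi⟩
  have hs1 : (1 : ℝ) ≤ s.card := by exact_mod_cast hspos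
  have hN : (s.card : ℝ) = Real.exp (k - 1) := by
    rw [hk, BlindDenoise.intrinsicDim, ← hcard, add_sub_cancel_left, Real.exp_log (by linarith)]
  have hNd : 1 ≤ (s.card : ℝ) * d := by nlinarith
  -- This is what the choice of the covering scale is made for.
  have hrb : BlindDenoise.coverScale d σT σ0 / σt * (σt / σT) ^ 2 * Real.sqrt d ≤ 1 := by
    have : BlindDenoise.coverScale d σT σ0 / σt * (σt / σT) ^ 2 * Real.sqrt d = σt / σ0 := by
      have : Real.sqrt d ≠ 0 := (Real.sqrt_pos.2 hd0).ne'
      unfold BlindDenoise.coverScale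
      field_simp
    rw [this]
    exact (div_le_one hσ0).2 hσt.2
  rw [hlam]
  refine (BlindDenoise.lintegral_precisionPosterior_noisyLaw_le pX (α := α)
    (q := ((s.card : ℝ) * d)⁻¹) (K := 4 * Real.log (s.card * d)) hT hσt hrpos.le (hCα.trans hC₀d)
    hd hrb
    (by have := Real.log_nonneg hNd; positivity) (by positivity)
    (inv_le_one_of_one_le₀ hNd) hs).trans ?_
  apply ENNReal.ofReal_le_ofReal
  calc _ ≤ ((σt ^ 2)⁻¹) ^ 2 * (C₀ * (1 + Real.log d) ^ 2 * (1 / d + k ^ 2 / d ^ 2)) := by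
        gcongr
        exact BlindDenoise.error_terms_le hd hk1 hk4 hN
    _ = _ := by ring
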